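/- For $f,g:\mathbb F_2^n\to\mathbb R$ let $\langle f,g\rangle=2^{-n}\sum_x f(x)g(x)$, $\|f\|_2=\sqrt{\langle f,f\rangle}$, and $\hat f(\alpha)=\langle f,\chi_\alpha\rangle$ with $\chi_\alpha(x)=(-1)^{\alpha\cdot x}$. Let $\mathcal F_s$ be the set of functions on $\mathbb F_2^n$ with at most $s$ non-zero Fourier coefficients, and $\mathrm{dist}_2(f,\mathcal F_s)=\min_{g\in\mathcal F_s}\|f-g\|_2$. There are a randomized query algorithm $\mathcal A$ and absolute constants $C>0$ and $k\in\mathbb N$ such that, for all $n$, all integers $s\ge 1$ and all $\epsilon\in(0,1]$ and $\delta\in(0,1/2]$, the algorithm $\mathcal A$ with parameters $(n,s,\epsilon,\delta)$ and query access to an unknown $f:\mathbb F_2^n\to\mathbb R$ with $\|f\|_2=1$ has the following properties. 1. It is non-adaptive: its list of queries is determined by its parameters and its internal randomness alone, and does not depend on $f$. It always makes at most $C\,\frac{s}{\epsilon^4}\log\frac1\epsilon\log\frac1\delta$ queries. 2. It always halts within time $C\,\frac{s}{\epsilon^4}\log\frac1\delta\,\bigl(1+\log\frac s\epsilon\bigr)^k$,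 that is, $\tilde O\bigl(\frac{s}{\epsilon^4}\log\frac1\delta\bigr)$, where $\tilde O$ suppresses factors polylogarithmic in $s$ and $1/\epsilon$. Time is counted on a random access machine on which drawing a uniformly random vector of $\mathbb F_2^n$, a query, an addition of vectors, an arithmetic operation or comparison of real numbers, and an addition, subtraction or comparison of integers each take one unit of time. 3. For every such $f$, its output $\xi$ satisfies $\bigl|\xi-\mathrm{dist}_2^2(f,\mathcal F_s)\bigr|\le\epsilon$ with probability at least $1-\delta$. Moreover, for every such $f$, $1-\mathrm{dist}_2^2(f,\mathcal F_s)=\max_{|S|\le s}\sum_{\alpha\in S}\hat f(\alpha)^2$ is the energy of the top $s$ Fourier coefficients of $f$, so that $1-\xi$ estimates this energy to within $\pm\epsilon$ in the same event. -/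

import Mathlib

open MeasureTheory

noncomputable section

namespace FourierSparsity

/-! ## Fourier analysis of real functions on `𝔽₂ⁿ` -/

/-- The vector space `𝔽₂ⁿ`. -/
abbrev Vec (n : ℕ) : Type := Fin n → ZMod 2

/-- The normalised inner product `⟨f, g⟩ = 𝔼ₓ [f x * g x]`. -/
def l2Inner {n : ℕ} (f g : Vec n → ℝ) : ℝ := (∑ x, f x * g x) / 2 ^ n

/-- The normalised norm `‖f‖₂ = √⟨f, f⟩`. -/
def l2Norm {n : ℕ} (f : Vec n → ℝ) : ℝ := Real.sqrt (l2Inner f f)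

/-- The character `χ_α x = (-1) ^ (α · x)`. -/
def chi {n : ℕ} (α x : Vec n) : ℝ := (-1) ^ (α ⬝ᵥ x).val

/-- The Fourier coefficient `𝔼ₓ [f x * χ_α x]`. -/
def fhat {n : ℕ} (f : Vec n → ℝ) (α : Vec n) : ℝ := l2Inner f (chi α)

/-- The class of Fourier `s`-sparse functions: at most `s` non-zero Fourier coefficients. -/
def sparseClass (n s : ℕ) : Set (Vec n → ℝ) :=
  {g | {α | fhat g α ≠ 0}.ncard ≤ s}

/-- The `ℓ₂`-distance from `f` to the class of `s`-sparse functions. The class contains `0`, so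
this is an infimum of a non-empty set of non-negative reals. -/
def distSparse {n : ℕ} (f : Vec n → ℝ) (s : ℕ) : ℝ :=
  sInf ((fun g => l2Norm (f - g)) '' sparseClass n s)

/-- The energies of sets of at most `s` Fourier coefficients of `f`. -/
def energies {n : ℕ} (f : Vec n → ℝ) (s : ℕ) : Set ℝ :=
  {e | ∃ S : Finset (Vec n), S.card ≤ s ∧ e = ∑ α ∈ S, fhat f α ^ 2}

/-! ## The machine model

A unit-cost random access machine with three memories, each an infinite sequence of cells:
natural numbers (also used as addresses), real numbers, and vectors of `𝔽₂ⁿ`. It can draw a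
uniformly random vector and query the unknown function at a vector it holds. Every instruction
and every test costs one time unit. There is no rounding from reals to integers and no unit-cost
multiplication of integers, and programs contain no real constants except rationals. -/

/-- An address: the cell `k` itself, or the cell whose index is in natural-number cell `k`. -/
inductive Addr : Type
  | dir (k : ℕ)
  | ind (k : ℕ)

/-- Elementary instructions. The first argument is the destination. -/
inductive Instr : Type
  | nconst (d : Addr) (c : ℕ)
  | ncopy (d a : Addr)
  | nadd (d a b : Addr)
  | nsub (d a b : Addr)
  | rconst (d : Addr) (q : ℚ)
  | rofNat (d a : Addr)
  | rcopy (d a : Addr)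
  | radd (d a b : Addr)
  | rsub (d a b : Addr)
  | rmul (d a b : Addr)
  | rdiv (d a b : Addr)
  | vzero (d : Addr)
  | vunit (d i : Addr)
  | vcopy (d a : Addr)
  | vadd (d a b : Addr)
  | vbit (d a i : Addr)
  | vrand (d : Addr)
  | query (d a : Addr)

/-- Tests: strict comparison of two natural-number cells, or of two real cells. -/
inductive Cond : Type
  | nlt (a b : Addr)
  | rlt (a b : Addr)

/-- Programs. A program is a finite object that mentions neither the dimension nor the function. -/
inductive Prog : Type
  | skip
  | op (i : Instr)
  | seq (p q : Prog)
  | ite (c : Cond) (p q : Prog)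
  | loop (c : Cond) (p : Prog)

/-- Machine states. `used` is the number of random vectors drawn so far, `asked` the list of all
queries made so far (the latest first, with repetitions), `time` the number of time units spent. -/
structure State (n : ℕ) : Type where
  nat : ℕ → ℕ
  real : ℕ → ℝ
  vec : ℕ → Vec n
  used : ℕ
  asked : List (Vec n)
  time : ℕ

/-- The index of the cell that an address refers to. -/
def Addr.loc {n : ℕ} (σ : State n) : Addr → ℕ
  | .dir k => k
  | .ind k => σ.nat k

namespace State

variable {n : ℕ} (σ : State n)

/-- Spend one unit of time. -/
def tick : State n := { σ with time := σ.time + 1 }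

/-- Write a natural number. -/
def setN (d : Addr) (v : ℕ) : State n := { σ with nat := Function.update σ.nat (d.loc σ) v }

/-- Write a real number. -/
def setR (d : Addr) (v : ℝ) : State n := { σ with real := Function.update σ.real (d.loc σ) v }

/-- Write a vector. -/
def setV (d : Addr) (v : Vec n) : State n := { σ with vec := Function.update σ.vec (d.loc σ) v }

/-- Read a natural number. -/
def getN (a : Addr) : ℕ := σ.nat (a.loc σ)

/-- Read a real number. -/
def getR (a : Addr) : ℝ := σ.real (a.loc σ)

/-- Read a vector. -/
def getV (a : Addr) : Vec n := σ.vec (a.loc σ)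

end State

/-- The effect of an instruction, without its cost, for the function `f` and the random tape `ω`.
-/
def Instr.effect {n : ℕ} (f : Vec n → ℝ) (ω : ℕ → Vec n) (σ : State n) : Instr → State n
  | .nconst d c => σ.setN d c
  | .ncopy d a => σ.setN d (σ.getN a)
  | .nadd d a b => σ.setN d (σ.getN a + σ.getN b)
  | .nsub d a b => σ.setN d (σ.getN a - σ.getN b)
  | .rconst d q => σ.setR d (q : ℝ)
  | .rofNat d a => σ.setR d (σ.getN a : ℝ)
  | .rcopy d a => σ.setR d (σ.getR a)
  | .radd d a b => σ.setR d (σ.getR a + σ.getR b)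
  | .rsub d a b => σ.setR d (σ.getR a - σ.getR b)
  | .rmul d a b => σ.setR d (σ.getR a * σ.getR b)
  | .rdiv d a b => σ.setR d (σ.getR a / σ.getR b)
  | .vzero d => σ.setV d 0
  | .vunit d i => σ.setV d (fun j => if (j : ℕ) = σ.getN i then 1 else 0)
  | .vcopy d a => σ.setV d (σ.getV a)
  | .vadd d a b => σ.setV d (σ.getV a + σ.getV b)
  | .vbit d a i => σ.setN d (if h : σ.getN i < n then (σ.getV a ⟨σ.getN i, h⟩).val else 0)
  | .vrand d => { σ.setV d (ω σ.used) with used := σ.used + 1 }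
  | .query d a => { σ.setR d (f (σ.getV a)) with asked := σ.getV a :: σ.asked }

/-- The truth of a test. -/
def Cond.holds {n : ℕ} (σ : State n) : Cond → Prop
  | .nlt a b => σ.getN a < σ.getN b
  | .rlt a b => σ.getR a < σ.getR b

/-- `Exec f ω p σ σ'`: with the function `f` and the random tape `ω`, the program `p` started in
the state `σ` terminates in the state `σ'`. -/
inductive Exec {n : ℕ} (f : Vec n → ℝ) (ω : ℕ → Vec n) : Prog → State n → State n → Prop
  | skip (σ : State n) : Exec f ω .skip σ σ
  | op (i : Instr) (σ : State n) : Exec f ω (.op i) σ (i.effect f ω σ).tick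
  | seq {p q : Prog} {σ₁ σ₂ σ₃ : State n} :
      Exec f ω p σ₁ σ₂ → Exec f ω q σ₂ σ₃ → Exec f ω (.seq p q) σ₁ σ₃
  | iteTrue {c : Cond} {p q : Prog} {σ₁ σ₂ : State n} :
      c.holds σ₁ → Exec f ω p σ₁.tick σ₂ → Exec f ω (.ite c p q) σ₁ σ₂
  | iteFalse {c : Cond} {p q : Prog} {σ₁ σ₂ : State n} :
      ¬ c.holds σ₁ → Exec f ω q σ₁.tick σ₂ → Exec f ω (.ite c p q) σ₁ σ₂
  | loopTrue {c : Cond} {p : Prog} {σ₁ σ₂ σ₃ : State n} :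
      c.holds σ₁ → Exec f ω p σ₁.tick σ₂ → Exec f ω (.loop c p) σ₂ σ₃ →
      Exec f ω (.loop c p) σ₁ σ₃
  | loopFalse {c : Cond} {p : Prog} {σ : State n} :
      ¬ c.holds σ → Exec f ω (.loop c p) σ σ.tick

/-- The initial state: natural-number cells 0 and 1 hold `n` and `s`, real cells 0 and 1 hold `ε`
and `δ`, and all other cells hold zero. -/
def State.init (n s : ℕ) (ε δ : ℝ) : State n where
  nat := fun k => if k = 0 then n else if k = 1 then s else 0
  real := fun k => if k = 0 then ε else if k = 1 then δ else 0
  vec := fun _ => 0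
  used := 0
  asked := []
  time := 0

/-- `Runs P n s ε δ f ω ξ Q t`: on the parameters `n, s, ε, δ`, with query access to `f` and the
random tape `ω`, the program `P` terminates after exactly `t` time units, having made exactly the
queries in the list `Q`, and its output (the final content of real cell 0) is `ξ`. -/
def Runs (P : Prog) (n s : ℕ) (ε δ : ℝ) (f : Vec n → ℝ) (ω : ℕ → Vec n)
    (ξ : ℝ) (Q : List (Vec n)) (t : ℕ) : Prop :=
  ∃ σ : State n, Exec f ω P (State.init n s ε δ) σ ∧
    σ.real 0 = ξ ∧ σ.asked = Q ∧ σ.time = t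

/-- The law of the random tape: independent, uniformly distributed vectors of `𝔽₂ⁿ`. -/
def tapeLaw (n : ℕ) : Measure (ℕ → Vec n) :=
  Measure.infinitePi fun _ : ℕ => (PMF.uniformOfFintype (Vec n)).toMeasure

end FourierSparsity

end

open FourierSparsity

noncomputable section

namespace FourierSparsity

/-! ## Fourier analysis -/

/-! The signs of the characters at `k` random vectors `u` hash the frequencies into `2 ^ k` buckets,
and `f` splits into the parts `fam k u f c`, whose spectra partition that of `f` (`fhat_fam`). The
values of all parts at one random point `b` depend only on `f` at the `2 ^ k` points obtained from
`b` by adding subset sums of `u`. One Walsh–Hadamard transform computes them all, and the square of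
a part at `b` is an unbiased estimate of the energy of its bucket.

Two things can go wrong: the squares deviate from the bucket energies, and several frequencies share
a bucket. `runError` measures both by sums of squares. Exact recursions for second and fourth
moments under one random split show that its mean is at most `4 / 2 ^ k` (`sum_runError_le`),
provided that the fourth moment of `f` is at most `2 ^ k`. Values of `f` that are too large are
therefore replaced by zero first; this changes every Fourier coefficient by at most `1 / √B`, where
`B = 2 ^ k` bounds the squares that are kept (`fhat_sub_trunc_sq_le`), and the energy of `s`
coefficients only slightly.

The sum of the `s` largest squares is then close to the energy of the top `s` coefficients: `x ≤ lam
* x ^ 2 + 1 / (4 * lam)` converts the squared errors into a linear error over at most `s` buckets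
(`sum_buckets_le`, `exists_sum_buckets_ge`). No sorting is needed: the dual bound `topBound`, at a
threshold found by bisection, is within `s` times the bisection gap of that sum (`topBound_le`).

With `2 ^ d` of order `s / ε ^ 2`, one run has mean error at most `ε / 2` (`mean_blockError_le`,
`error_budget`). Hoeffding's inequality for order `log (1 / δ) / ε ^ 2` independent runs gives
confidence `1 - δ` (`tapeLaw_mean_le`). The queried points are sums of vectors on the tape, so
non-adaptivity is visible in `allQueries`. A total-correctness calculus (`WP`) ties the actual
program to this analysis and bounds its time on every tape. For `ε ≥ 1 / 2` the constant answer `1 /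
2` needs no query. -/

theorem neg_one_pow_val_add (a b : ZMod 2) :
    (-1 : ℝ) ^ (a + b).val = (-1) ^ a.val * (-1) ^ b.val := by
  rw [ZMod.val_add, ← neg_one_pow_eq_pow_mod_two, pow_add]

theorem chi_comm {n : ℕ} (α x : Vec n) : chi α x = chi x α := by
  simp only [chi, dotProduct_comm]

theorem chi_add_right {n : ℕ} (α x y : Vec n) : chi α (x + y) = chi α x * chi α y := by
  simp only [chi, dotProduct_add, neg_one_pow_val_add]

theorem chi_add_left {n : ℕ} (α β x : Vec n) : chi (α + β) x = chi α x * chi β x := by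
  simp only [chi, add_dotProduct, neg_one_pow_val_add]

theorem chi_mul_self {n : ℕ} (α x : Vec n) : chi α x * chi α x = 1 := by
  simp only [chi, ← pow_add, ← two_mul, pow_mul]; simp

theorem chi_eq_or {n : ℕ} (α x : Vec n) : chi α x = 1 ∨ chi α x = -1 :=
  neg_one_pow_eq_or ℝ _

theorem chi_zero_right {n : ℕ} (α : Vec n) : chi α 0 = 1 := by simp [chi]

theorem add_self_vec {n : ℕ} (x : Vec n) : x + x = 0 := by
  ext i; exact CharTwo.add_self_eq_zero (x i)

theorem add_eq_zero_iff_vec {n : ℕ} (x y : Vec n) : x + y = 0 ↔ x = y := by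
  constructor
  · intro h
    have : x + y + y = y := by rw [h, zero_add]
    rwa [add_assoc, add_self_vec, add_zero] at this
  · rintro rfl; exact add_self_vec x

theorem card_vec (n : ℕ) : (Fintype.card (Vec n) : ℝ) = 2 ^ n := by
  simp [Vec, ZMod.card]

theorem sum_chi_left {n : ℕ} (x : Vec n) : ∑ α, chi α x = if x = 0 then (2 : ℝ) ^ n else 0 := by
  split_ifs with h
  · subst h; simp only [chi_zero_right, Finset.sum_const, nsmul_eq_mul, mul_one]
    exact card_vec n
  -- Translating `α` by the unit vector at a non-zero coordinate of `x` flips the sign of every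
  -- term, so the sum equals its own negative.
  · obtain ⟨i, hi⟩ := Function.ne_iff.1 h
    set e : Vec n := Pi.single i 1 with he
    have h1 : chi e x = -1 := by
      have : x i = 1 := by
        have h2 : ∀ a : ZMod 2, a ≠ 0 → a = 1 := by decide
        exact h2 _ hi
      simp [chi, he, this, ZMod.val_one]
    have h2 : ∑ α, chi α x = ∑ α, chi (α + e) x :=
      (Equiv.sum_comp (Equiv.addRight e) fun α => chi α x).symm
    simp only [chi_add_left, h1, mul_neg, mul_one, Finset.sum_neg_distrib] at h2
    linarith

theorem parseval_inner {n : ℕ} (f g : Vec n → ℝ) :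
    ∑ α, fhat f α * fhat g α = l2Inner f g := by
  have h0 : (2 : ℝ) ^ n ≠ 0 := by positivity
  have h1 : ∀ α, fhat f α * fhat g α
      = (∑ x, ∑ y, f x * g y * chi α (x + y)) / (2 ^ n * 2 ^ n) := by
    intro α
    simp only [fhat, l2Inner, div_mul_div_comm, Finset.sum_mul_sum, chi_add_right]
    congr 1
    refine Finset.sum_congr rfl fun x _ => Finset.sum_congr rfl fun y _ => ?_
    ring
  simp only [h1, ← Finset.sum_div]
  rw [Finset.sum_comm]
  have h2 : ∀ x, ∑ α, ∑ y, f x * g y * chi α (x + y) = f x * g x * 2 ^ n := by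
    intro x
    rw [Finset.sum_comm]
    simp only [← Finset.mul_sum, sum_chi_left, add_eq_zero_iff_vec]
    simp
  simp only [h2, ← Finset.sum_mul, l2Inner]
  field_simp

theorem parseval {n : ℕ} (f : Vec n → ℝ) : ∑ α, fhat f α ^ 2 = l2Inner f f := by
  simp only [← parseval_inner, sq]

theorem l2Inner_self_nonneg {n : ℕ} (f : Vec n → ℝ) : 0 ≤ l2Inner f f := by
  rw [← parseval]; positivity

theorem l2Norm_sq {n : ℕ} (f : Vec n → ℝ) : l2Norm f ^ 2 = l2Inner f f :=
  Real.sq_sqrt (l2Inner_self_nonneg f)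

theorem fhat_sub {n : ℕ} (f g : Vec n → ℝ) (α : Vec n) :
    fhat (f - g) α = fhat f α - fhat g α := by
  simp only [fhat, l2Inner, Pi.sub_apply, sub_mul, Finset.sum_sub_distrib, sub_div]

theorem fhat_sum_chi {n : ℕ} (c : Vec n → ℝ) (β : Vec n) :
    fhat (fun x => ∑ α, c α * chi α x) β = c β := by
  have h0 : (2 : ℝ) ^ n ≠ 0 := by positivity
  simp only [fhat, l2Inner, Finset.sum_mul]
  rw [Finset.sum_comm]
  have h2 : ∀ α, ∑ x, c α * chi α x * chi β x = c α * if α = β then 2 ^ n else 0 := by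
    intro α
    have : ∀ x, c α * chi α x * chi β x = c α * chi x (α + β) := by
      intro x; rw [chi_comm x, chi_add_left, mul_assoc]
    simp only [this, ← Finset.mul_sum, sum_chi_left, add_eq_zero_iff_vec]
  simp only [h2]
  simp [h0]

/-! ## The distance to sparse functions -/

theorem exists_isGreatest_energies {n : ℕ} (f : Vec n → ℝ) (s : ℕ) :
    ∃ S : Finset (Vec n), S.card ≤ s ∧
      ∀ S' : Finset (Vec n), S'.card ≤ s → ∑ α ∈ S', fhat f α ^ 2 ≤ ∑ α ∈ S, fhat f α ^ 2 := by
  classical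
  obtain ⟨S, hS, hmax⟩ := Finset.exists_max_image
    (Finset.univ.filter fun S : Finset (Vec n) => S.card ≤ s)
    (fun S => ∑ α ∈ S, fhat f α ^ 2) ⟨∅, by simp⟩
  exact ⟨S, by simpa using hS, fun S' h => hmax S' (by simpa using h)⟩

/-- By Parseval, a function with spectrum in `A` is at squared distance at least the energy of `f`
outside `A`, with equality for the projection of `f` to `A`. The projection to an optimal `S`
therefore attains the infimum. -/
theorem distSparse_sq {n : ℕ} (f : Vec n → ℝ) (s : ℕ) {S : Finset (Vec n)} (hS : S.card ≤ s)
    (hmax : ∀ S' : Finset (Vec n), S'.card ≤ s →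
      ∑ α ∈ S', fhat f α ^ 2 ≤ ∑ α ∈ S, fhat f α ^ 2) :
    distSparse f s ^ 2 = l2Inner f f - ∑ α ∈ S, fhat f α ^ 2 := by
  classical
  have key : ∀ (g : Vec n → ℝ) (A : Finset (Vec n)), (∀ α ∉ A, fhat g α = 0) →
      l2Inner f f - ∑ α ∈ A, fhat f α ^ 2 ≤ l2Inner (f - g) (f - g) := by
    intro g A hA
    rw [← parseval, ← parseval, ← Finset.sum_add_sum_compl A,
      ← Finset.sum_add_sum_compl A (fun α => fhat (f - g) α ^ 2)]
    have h1 : ∑ α ∈ Aᶜ, fhat (f - g) α ^ 2 = ∑ α ∈ Aᶜ, fhat f α ^ 2 :=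
      Finset.sum_congr rfl fun α hα => by
        rw [fhat_sub, hA α (by simpa using hα), sub_zero]
    have h2 : 0 ≤ ∑ α ∈ A, fhat (f - g) α ^ 2 := Finset.sum_nonneg fun _ _ => sq_nonneg _
    linarith
  set g₀ : Vec n → ℝ := fun x => ∑ α, (if α ∈ S then fhat f α else 0) * chi α x with hg₀
  have hg₀hat : ∀ α, fhat g₀ α = if α ∈ S then fhat f α else 0 := fun α =>
    fhat_sum_chi (fun α => if α ∈ S then fhat f α else 0) α
  have hmem : g₀ ∈ sparseClass n s := by
    have hsub : {α | fhat g₀ α ≠ 0} ⊆ (S : Set (Vec n)) := by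
      intro α hα
      by_contra h
      exact hα (by rw [hg₀hat, if_neg (by simpa using h)])
    calc _ ≤ (S : Set (Vec n)).ncard := Set.ncard_le_ncard hsub (Set.toFinite _)
      _ ≤ s := by rwa [Set.ncard_coe_finset]
  have heq : l2Inner (f - g₀) (f - g₀) = l2Inner f f - ∑ α ∈ S, fhat f α ^ 2 := by
    rw [← parseval, ← parseval, ← Finset.sum_add_sum_compl S,
      ← Finset.sum_add_sum_compl S (fun α => fhat f α ^ 2)]
    have h1 : ∑ α ∈ Sᶜ, fhat (f - g₀) α ^ 2 = ∑ α ∈ Sᶜ, fhat f α ^ 2 :=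
      Finset.sum_congr rfl fun α hα => by
        rw [fhat_sub, hg₀hat, if_neg (by simpa using hα), sub_zero]
    have h2 : ∑ α ∈ S, fhat (f - g₀) α ^ 2 = 0 := Finset.sum_eq_zero fun α hα => by
        rw [fhat_sub, hg₀hat, if_pos hα, sub_self, sq, zero_mul]
    rw [h1, h2]; ring
  have hdist : distSparse f s = l2Norm (f - g₀) := by
    refine IsLeast.csInf_eq ⟨⟨g₀, hmem, rfl⟩, ?_⟩
    rintro _ ⟨g, hg, rfl⟩
    refine Real.sqrt_le_sqrt ?_
    rw [heq]
    set A := Finset.univ.filter fun α => fhat g α ≠ 0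
    have hAs : A.card ≤ s := by
      have : {α | fhat g α ≠ 0} = (A : Set (Vec n)) := by ext; simp [A]
      have h : {α | fhat g α ≠ 0}.ncard ≤ s := hg
      rwa [this, Set.ncard_coe_finset] at h
    have := key g A fun α hα => by simpa [A] using hα
    linarith [hmax A hAs]
  rw [hdist, l2Norm_sq, heq]

theorem isGreatest_energies {n : ℕ} (f : Vec n → ℝ) (s : ℕ) (hf : l2Norm f = 1) :
    IsGreatest (energies f s) (1 - distSparse f s ^ 2) := by
  obtain ⟨S, hS, hmax⟩ := exists_isGreatest_energies f s
  rw [distSparse_sq f s hS hmax, ← l2Norm_sq, hf]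
  refine ⟨⟨S, hS, by ring⟩, ?_⟩
  rintro _ ⟨A, hA, rfl⟩
  linarith [hmax A hA]

/-! ## Splitting a function by random characters -/

/-- The parts of `f` on the frequencies `α` with `χ_α v = 1` (for even `t`) and `χ_α v = -1`. -/
def half {n : ℕ} (f : Vec n → ℝ) (v : Vec n) (t : ℕ) (x : Vec n) : ℝ :=
  (f x + (-1) ^ t * f (x + v)) / 2

/-- The part of `f` in the `c`-th bucket of the hash function given by `u`. -/
def fam {n : ℕ} : (k : ℕ) → (Fin k → Vec n) → (Vec n → ℝ) → ℕ → Vec n → ℝ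
  | 0, _, f, _ => f
  | k + 1, u, f, c => half (fam k (Fin.init u) f (c / 2)) (u (Fin.last k)) (c % 2)

/-- The index of the bucket of a frequency. -/
def bucket {n : ℕ} : (k : ℕ) → (Fin k → Vec n) → Vec n → ℕ
  | 0, _, _ => 0
  | k + 1, u, α => 2 * bucket k (Fin.init u) α + if chi α (u (Fin.last k)) = 1 then 0 else 1

/-- The fourth moment. -/
def m4 {n : ℕ} (f : Vec n → ℝ) : ℝ := (∑ x, f x ^ 4) / 2 ^ n

theorem sum_translate {n : ℕ} (g : Vec n → ℝ) (v : Vec n) : ∑ x, g (x + v) = ∑ x, g x :=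
  Equiv.sum_comp (Equiv.addRight v) g

theorem fhat_translate {n : ℕ} (f : Vec n → ℝ) (v α : Vec n) :
    fhat (fun x => f (x + v)) α = fhat f α * chi α v := by
  simp only [fhat, l2Inner]
  rw [div_mul_eq_mul_div, Finset.sum_mul, ← sum_translate _ v]
  congr 1
  refine Finset.sum_congr rfl fun x _ => ?_
  rw [add_assoc, add_self_vec, add_zero, chi_add_right, mul_assoc]

theorem fhat_half {n : ℕ} (f : Vec n → ℝ) (v : Vec n) (t : ℕ) (α : Vec n) :
    fhat (half f v t) α = fhat f α * ((1 + (-1) ^ t * chi α v) / 2) := by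
  have h := fhat_translate f v α
  have h2 : fhat (half f v t) α
      = (fhat f α + (-1) ^ t * fhat (fun x => f (x + v)) α) / 2 := by
    simp only [fhat, l2Inner, half]
    rw [← mul_div_assoc, ← add_div, div_right_comm]
    congr 1
    rw [Finset.mul_sum, ← Finset.sum_add_distrib, Finset.sum_div]
    exact Finset.sum_congr rfl fun x _ => by ring
  rw [h2, h]; ring

theorem bucket_lt {n : ℕ} (k : ℕ) (u : Fin k → Vec n) (α : Vec n) : bucket k u α < 2 ^ k := by
  induction k with
  | zero => simp [bucket]
  | succ k ih =>
    have := ih (Fin.init u)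
    simp only [bucket, pow_succ]
    split_ifs <;> omega

/-- Each split multiplies a coefficient by `1` or `0`, according to whether the last binary digit of
`c` agrees with the sign of the character at the new vector. -/
theorem fhat_fam {n : ℕ} (k : ℕ) (u : Fin k → Vec n) (f : Vec n → ℝ) (c : ℕ) (hc : c < 2 ^ k)
    (α : Vec n) : fhat (fam k u f c) α = if c = bucket k u α then fhat f α else 0 := by
  induction k generalizing c with
  | zero =>
    have : c = 0 := by simpa using hc
    simp [fam, bucket, this]
  | succ k ih =>
    rw [pow_succ] at hc
    rw [fam, fhat_half, ih _ _ (by omega), bucket]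
    have hm : c % 2 = 0 ∨ c % 2 = 1 := by omega
    have hdm := Nat.div_add_mod c 2
    have hne : (-1 : ℝ) ≠ 1 := by norm_num
    by_cases h : c / 2 = bucket k (Fin.init u) α
    · rcases chi_eq_or α (u (Fin.last k)) with h1 | h1 <;> rcases hm with h2 | h2
      · rw [if_pos h, h1, h2, if_pos rfl, if_pos (by omega)]; norm_num
      · rw [if_pos h, h1, h2, if_pos rfl, if_neg (by omega)]; norm_num
      · rw [if_pos h, h1, h2, if_neg hne, if_neg (by omega)]; norm_num
      · rw [if_pos h, h1, h2, if_neg hne, if_pos (by omega)]; norm_num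
    · rw [if_neg h, if_neg, zero_mul]
      split_ifs <;> omega

/-! ### Moments of the parts, averaged over the splitting vectors -/

theorem sum_range_two_pow_succ (k : ℕ) (G : ℕ → ℝ) :
    ∑ c ∈ Finset.range (2 ^ (k + 1)), G c
      = ∑ c ∈ Finset.range (2 ^ k), (G (2 * c) + G (2 * c + 1)) := by
  rw [pow_succ, mul_comm]
  induction 2 ^ k with
  | zero => simp
  | succ m ih =>
    rw [Finset.sum_range_succ, ← ih, show 2 * (m + 1) = 2 * m + 1 + 1 by ring,
      Finset.sum_range_succ, Finset.sum_range_succ]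
    ring

theorem fam_succ_even {n : ℕ} (k : ℕ) (u : Fin k → Vec n) (x : Vec n) (f : Vec n → ℝ) (c : ℕ) :
    fam (k + 1) (Fin.snoc u x) f (2 * c) = half (fam k u f c) x 0 := by
  simp [fam]

theorem fam_succ_odd {n : ℕ} (k : ℕ) (u : Fin k → Vec n) (x : Vec n) (f : Vec n → ℝ) (c : ℕ) :
    fam (k + 1) (Fin.snoc u x) f (2 * c + 1) = half (fam k u f c) x 1 := by
  have h1 : (2 * c + 1) / 2 = c := by omega
  have h2 : (2 * c + 1) % 2 = 1 := by omega
  simp [fam, h1, h2]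

/-- The odd cross terms cancel between the two halves: `((a + b) / 2) ^ 4 + ((a - b) / 2) ^ 4 = (a ^
4 + 6 * a ^ 2 * b ^ 2 + b ^ 4) / 8`. With `a = f x` and `b = f (x + v)`, averaging over `v` makes
the mixed term a product of two second moments. -/
theorem sum_half_m4 {n : ℕ} (f : Vec n → ℝ) :
    ∑ v, (m4 (half f v 0) + m4 (half f v 1))
      = 2 ^ n * (m4 f / 4 + 3 / 4 * l2Inner f f ^ 2) := by
  have h0 : (2 : ℝ) ^ n ≠ 0 := by positivity
  have h1 : ∀ v, m4 (half f v 0) + m4 (half f v 1)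
      = (∑ x, (f x ^ 4 + 6 * (f x * f x) * (f (x + v) * f (x + v)) + f (x + v) ^ 4)) / 8
        / 2 ^ n := by
    intro v
    simp only [m4, ← add_div, ← Finset.sum_add_distrib]
    rw [Finset.sum_div _ _ (8 : ℝ)]
    congr 1
    refine Finset.sum_congr rfl fun x _ => ?_
    simp only [half]; ring
  have h2 : ∀ (g : Vec n → ℝ) (x : Vec n), ∑ v, g (x + v) = ∑ v, g v := by
    intro g x
    simp only [add_comm x]; exact sum_translate g x
  simp only [h1, ← Finset.sum_div]
  rw [Finset.sum_comm]
  simp only [Finset.sum_add_distrib, ← Finset.mul_sum, h2 (fun x => f x * f x),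
    h2 (fun x => f x ^ 4), ← Finset.sum_mul, m4, l2Inner, Finset.sum_const, nsmul_eq_mul,
    Finset.card_univ, card_vec]
  field_simp
  ring

theorem l2Inner_half {n : ℕ} (f : Vec n → ℝ) (v : Vec n) (t : ℕ) :
    l2Inner (half f v t) (half f v t)
      = (l2Inner f f + (-1) ^ t * ∑ α, fhat f α ^ 2 * chi α v) / 2 := by
  rw [← parseval, ← parseval, Finset.mul_sum, ← Finset.sum_add_distrib, Finset.sum_div]
  refine Finset.sum_congr rfl fun α _ => ?_
  have h1 : ((-1 : ℝ) ^ t) ^ 2 = 1 := by rw [← pow_mul, mul_comm, pow_mul]; simp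
  have h2 := chi_mul_self α v
  rw [fhat_half]
  linear_combination fhat f α ^ 2 / 4 * chi α v ^ 2 * h1 + fhat f α ^ 2 / 4 * h2

/-- The halves have energies `(E ± D v) / 2`, where `D` is the function of `v` with Fourier
coefficients `fhat f α ^ 2`. The squares add up to `(E ^ 2 + D v ^ 2) / 2`, and Parseval in the
variable `v` gives the mean of `D ^ 2`. -/
theorem sum_half_l2Inner_sq {n : ℕ} (f : Vec n → ℝ) :
    ∑ v, (l2Inner (half f v 0) (half f v 0) ^ 2 + l2Inner (half f v 1) (half f v 1) ^ 2)
      = 2 ^ n * (l2Inner f f ^ 2 / 2 + (∑ α, fhat f α ^ 4) / 2) := by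
  have h0 : (2 : ℝ) ^ n ≠ 0 := by positivity
  have h1 := parseval fun v => ∑ α, fhat f α ^ 2 * chi α v
  simp only [fhat_sum_chi fun α => fhat f α ^ 2] at h1
  have h2 : ∑ v, (∑ α, fhat f α ^ 2 * chi α v) ^ 2 = 2 ^ n * ∑ α, fhat f α ^ 4 := by
    have : ∀ α, (fhat f α ^ 2) ^ 2 = fhat f α ^ 4 := fun α => by ring
    simp only [this] at h1
    rw [h1, l2Inner]
    field_simp
  have h3 : ∀ v, l2Inner (half f v 0) (half f v 0) ^ 2 + l2Inner (half f v 1) (half f v 1) ^ 2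
      = l2Inner f f ^ 2 / 2 + (∑ α, fhat f α ^ 2 * chi α v) ^ 2 / 2 := by
    intro v; rw [l2Inner_half, l2Inner_half]; ring
  simp only [h3, Finset.sum_add_distrib, ← Finset.sum_div, h2, Finset.sum_const, nsmul_eq_mul,
    Finset.card_univ, card_vec]
  ring

theorem sum_fin_succ {n : ℕ} (k : ℕ) (G : (Fin (k + 1) → Vec n) → ℝ) :
    ∑ u, G u = ∑ u : Fin k → Vec n, ∑ x : Vec n, G (Fin.snoc u x) := by
  rw [← Equiv.sum_comp (Fin.snocEquiv fun _ => Vec n), Fintype.sum_prod_type, Finset.sum_comm]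
  rfl

/-- The excess over the fourth powers is the energy of pairs of distinct frequencies in a common
bucket. Each random vector separates such a pair with probability one half, so the mean excess
halves at every level. -/
theorem sum_fam_l2Inner_sq {n : ℕ} (f : Vec n → ℝ) (k : ℕ) :
    ∑ u : Fin k → Vec n, ∑ c ∈ Finset.range (2 ^ k), l2Inner (fam k u f c) (fam k u f c) ^ 2
      = (2 ^ n) ^ k * ((∑ α, fhat f α ^ 4)
        + (l2Inner f f ^ 2 - ∑ α, fhat f α ^ 4) / 2 ^ k) := by
  induction k with
  | zero => simp [fam]
  | succ k ih =>
    rw [sum_fin_succ]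
    simp only [sum_range_two_pow_succ, fam_succ_even, fam_succ_odd]
    have h1 : ∀ u : Fin k → Vec n, ∑ c ∈ Finset.range (2 ^ k), ∑ α, fhat (fam k u f c) α ^ 4
        = ∑ α, fhat f α ^ 4 := by
      intro u
      rw [Finset.sum_comm]
      refine Finset.sum_congr rfl fun α _ => ?_
      rw [Finset.sum_eq_single_of_mem (bucket k u α) (Finset.mem_range.2 (bucket_lt k u α))]
      · rw [fhat_fam _ _ _ _ (bucket_lt k u α), if_pos rfl]
      · intro c hc hne
        rw [fhat_fam _ _ _ _ (Finset.mem_range.1 hc), if_neg hne]; norm_num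
    have h2 : ∀ u : Fin k → Vec n, ∑ x, ∑ c ∈ Finset.range (2 ^ k),
        (l2Inner (half (fam k u f c) x 0) (half (fam k u f c) x 0) ^ 2
          + l2Inner (half (fam k u f c) x 1) (half (fam k u f c) x 1) ^ 2)
        = 2 ^ n * ((∑ c ∈ Finset.range (2 ^ k), l2Inner (fam k u f c) (fam k u f c) ^ 2) / 2
          + (∑ α, fhat f α ^ 4) / 2) := by
      intro u
      rw [Finset.sum_comm]
      simp only [sum_half_l2Inner_sq]
      simp only [← Finset.mul_sum, Finset.sum_add_distrib, ← Finset.sum_div]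
      rw [← h1 u]
    simp only [h2]
    simp only [← Finset.mul_sum, Finset.sum_add_distrib, ← Finset.sum_div, ih,
      Finset.sum_const, nsmul_eq_mul, Finset.card_univ, Fintype.card_pi, Finset.prod_const,
      Fintype.card_fin, Nat.cast_pow, ZMod.card, Nat.cast_ofNat]
    rw [pow_succ (2 ^ n : ℝ) k, pow_succ (2 : ℝ) k, ← div_div _ ((2 : ℝ) ^ k) 2]
    ring

theorem sum_pow_four_le {n : ℕ} (f : Vec n → ℝ) : ∑ α, fhat f α ^ 4 ≤ l2Inner f f ^ 2 := by
  rw [← parseval]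
  have : ∀ α, fhat f α ^ 4 = (fhat f α ^ 2) ^ 2 := fun α => by ring
  simp only [this]
  exact Finset.sum_sq_le_sq_sum_of_nonneg (fun α _ => sq_nonneg (fhat f α))

/-- The mean obeys `M (k + 1) = M k / 4 + 3 / 4 * Q k`, with `Q` the mean sum of squared energies
just computed. The right-hand side is an exact solution of this recursion, and `3` is forced as the
fixed point `x / 4 + 3 / 4 = x / 2`; the inequality is lost only at `k = 0`. -/
theorem sum_fam_m4_le {n : ℕ} (f : Vec n → ℝ) (k : ℕ) :
    ∑ u : Fin k → Vec n, ∑ c ∈ Finset.range (2 ^ k), m4 (fam k u f c)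
      ≤ (2 ^ n) ^ k * ((∑ α, fhat f α ^ 4)
        + 3 * ((l2Inner f f ^ 2 - ∑ α, fhat f α ^ 4) / 2 ^ k) + m4 f / 4 ^ k) := by
  induction k with
  | zero =>
    have := sum_pow_four_le f
    simp [fam]
    have h2 : 0 ≤ ∑ α, fhat f α ^ 4 := Finset.sum_nonneg fun _ _ => by positivity
    linarith
  | succ k ih =>
    rw [sum_fin_succ]
    simp only [sum_range_two_pow_succ, fam_succ_even, fam_succ_odd]
    have h2 : ∀ u : Fin k → Vec n, ∑ x, ∑ c ∈ Finset.range (2 ^ k),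
        (m4 (half (fam k u f c) x 0) + m4 (half (fam k u f c) x 1))
        = 2 ^ n * ((∑ c ∈ Finset.range (2 ^ k), m4 (fam k u f c)) / 4
          + 3 / 4 * ∑ c ∈ Finset.range (2 ^ k), l2Inner (fam k u f c) (fam k u f c) ^ 2) := by
      intro u
      rw [Finset.sum_comm]
      simp only [sum_half_m4]
      simp only [← Finset.mul_sum, Finset.sum_add_distrib, ← Finset.sum_div]
    simp only [h2]
    simp only [← Finset.mul_sum, Finset.sum_add_distrib, ← Finset.sum_div, sum_fam_l2Inner_sq]
    have h3 : (0 : ℝ) ≤ 2 ^ n / 4 := by positivity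
    have h4 := mul_le_mul_of_nonneg_left ih h3
    rw [pow_succ (2 ^ n : ℝ) k, pow_succ (2 : ℝ) k, pow_succ (4 : ℝ) k]
    have e1 : ∀ X : ℝ, X / (2 ^ k * 2) = X / 2 ^ k / 2 := fun X => by rw [div_div]
    have e2 : ∀ X : ℝ, X / (4 ^ k * 4) = X / 4 ^ k / 4 := fun X => by rw [div_div]
    rw [e1, e2]
    linarith

/-- The total squared deviation of the bucket estimates from the bucket energies, plus the
collision energy of the buckets. -/
def runError {n : ℕ} (f : Vec n → ℝ) (k : ℕ) (u : Fin k → Vec n) (b : Vec n) : ℝ :=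
  ∑ c ∈ Finset.range (2 ^ k), (fam k u f c b ^ 2 - l2Inner (fam k u f c) (fam k u f c)) ^ 2
    + (∑ c ∈ Finset.range (2 ^ k), l2Inner (fam k u f c) (fam k u f c) ^ 2
      - ∑ α, fhat f α ^ 4)

/-- The variance of `g b ^ 2` is `m4 g - l2Inner g g ^ 2`, so the squared energies cancel against
those in the collision term, and only the fourth moments minus `∑ fhat f α ^ 4` remain. Of the `4`,
three units come from collisions and one from `m4 f / 4 ^ k`, where `h4` is used. -/
theorem sum_runError_le {n : ℕ} (f : Vec n → ℝ) (k : ℕ) (hf : l2Inner f f ≤ 1)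
    (h4 : m4 f ≤ 2 ^ k) :
    ∑ u : Fin k → Vec n, ∑ b, runError f k u b ≤ (2 ^ n) ^ (k + 1) * (4 / 2 ^ k) := by
  have h0 : (2 : ℝ) ^ n ≠ 0 := by positivity
  have h1 : ∀ u : Fin k → Vec n, ∑ b, runError f k u b
      = 2 ^ n * (∑ c ∈ Finset.range (2 ^ k), m4 (fam k u f c) - ∑ α, fhat f α ^ 4) := by
    intro u
    simp only [runError, Finset.sum_add_distrib, Finset.sum_const, nsmul_eq_mul,
      Finset.card_univ, card_vec]
    rw [Finset.sum_comm]
    have h2 : ∀ g : Vec n → ℝ, ∑ b, (g b ^ 2 - l2Inner g g) ^ 2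
        = 2 ^ n * (m4 g - l2Inner g g ^ 2) := by
      intro g
      have e1 : ∑ b, g b ^ 4 = 2 ^ n * m4 g := by rw [m4]; field_simp
      have e2 : ∑ b, g b * g b = 2 ^ n * l2Inner g g := by rw [l2Inner]; field_simp
      have e3 : ∀ b, (g b ^ 2 - l2Inner g g) ^ 2
          = g b ^ 4 - 2 * l2Inner g g * (g b * g b) + l2Inner g g ^ 2 := fun b => by ring
      simp only [e3, Finset.sum_add_distrib, Finset.sum_sub_distrib, ← Finset.mul_sum, e1, e2,
        Finset.sum_const, nsmul_eq_mul, Finset.card_univ, card_vec]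
      ring
    simp only [h2, ← Finset.mul_sum, Finset.sum_sub_distrib]
    ring
  simp only [h1, ← Finset.mul_sum, Finset.sum_sub_distrib, Finset.sum_const, nsmul_eq_mul,
    Finset.card_univ]
  have h5 := sum_fam_m4_le f k
  have h6 : ((Fintype.card (Fin k → Vec n) : ℕ) : ℝ) = (2 ^ n) ^ k := by
    rw [Fintype.card_pi, Finset.prod_const, Nat.cast_pow, card_vec]; simp
  rw [h6]
  have hP : (0 : ℝ) < (2 ^ n) ^ k := by positivity
  have hK : (0 : ℝ) < 2 ^ k := by positivity
  have h7 : (l2Inner f f ^ 2 - ∑ α, fhat f α ^ 4) / 2 ^ k ≤ 1 / 2 ^ k := by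
    have : 0 ≤ ∑ α, fhat f α ^ 4 := Finset.sum_nonneg fun _ _ => by positivity
    have h8 := l2Inner_self_nonneg f
    gcongr
    nlinarith
  have h8 : m4 f / 4 ^ k ≤ 1 / 2 ^ k := by
    have : (4 : ℝ) ^ k = 2 ^ k * 2 ^ k := by rw [← mul_pow]; norm_num
    rw [this, ← div_div]
    gcongr
    rwa [div_le_one hK]
  have h9 : (2 ^ n : ℝ) ^ k * ((∑ α, fhat f α ^ 4)
        + 3 * ((l2Inner f f ^ 2 - ∑ α, fhat f α ^ 4) / 2 ^ k) + m4 f / 4 ^ k)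
      ≤ (2 ^ n) ^ k * ((∑ α, fhat f α ^ 4) + 4 / 2 ^ k) := by
    refine mul_le_mul_of_nonneg_left ?_ hP.le
    have : (4 : ℝ) / 2 ^ k = 3 * (1 / 2 ^ k) + 1 / 2 ^ k := by ring
    rw [this]; linarith
  rw [pow_succ (2 ^ n : ℝ) k, mul_comm ((2 ^ n : ℝ) ^ k) (2 ^ n), mul_assoc]
  refine mul_le_mul_of_nonneg_left ?_ (by positivity)
  linarith

/-! ## Comparison of the bucket estimates with the top coefficients -/

/-- Used instead of Cauchy–Schwarz: the bound stays linear in `runError`, so it can be averaged over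
the randomness directly. -/
theorem le_sq_add {lam : ℝ} (hl : 0 < lam) (x : ℝ) : x ≤ lam * x ^ 2 + 1 / (4 * lam) := by
  have : lam * x ^ 2 + 1 / (4 * lam) - x = (2 * lam * x - 1) ^ 2 / (4 * lam) := by
    field_simp; ring
  have h2 : 0 ≤ (2 * lam * x - 1) ^ 2 / (4 * lam) := by positivity
  linarith

theorem sum_fhat_fam_pow {n : ℕ} (k : ℕ) (u : Fin k → Vec n) (f : Vec n → ℝ) (m : ℕ) (hm : m ≠ 0) :
    ∑ c ∈ Finset.range (2 ^ k), ∑ α, fhat (fam k u f c) α ^ m = ∑ α, fhat f α ^ m := by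
  rw [Finset.sum_comm]
  refine Finset.sum_congr rfl fun α _ => ?_
  rw [Finset.sum_eq_single_of_mem (bucket k u α) (Finset.mem_range.2 (bucket_lt k u α))]
  · rw [fhat_fam _ _ _ _ (bucket_lt k u α), if_pos rfl]
  · intro c hc hne
    rw [fhat_fam _ _ _ _ (Finset.mem_range.1 hc), if_neg hne, zero_pow hm]

/-- Each square is split as `m c + (E c - m c) + (fam ^ 2 - E c)`, with `m c` the largest squared
coefficient in bucket `c`. The `m c` with `c ∈ S` come from different frequencies, so their sum is
at most `T`; the two differences are paid for by the two terms of `runError`. -/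
theorem sum_buckets_le {n : ℕ} (f : Vec n → ℝ) (k : ℕ) (u : Fin k → Vec n) (b : Vec n)
    {s : ℕ} {T lam : ℝ} (hl : 0 < lam)
    (hT : ∀ A : Finset (Vec n), A.card ≤ s → ∑ α ∈ A, fhat f α ^ 2 ≤ T)
    {S : Finset ℕ} (hS : S ⊆ Finset.range (2 ^ k)) (hs : S.card ≤ s) :
    ∑ c ∈ S, fam k u f c b ^ 2 ≤ T + lam * runError f k u b + s / (2 * lam) := by
  classical
  have hex : ∀ c, ∃ α, ∀ β, fhat (fam k u f c) β ^ 2 ≤ fhat (fam k u f c) α ^ 2 := by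
    intro c
    obtain ⟨α, -, h⟩ := Finset.exists_max_image (Finset.univ : Finset (Vec n))
      (fun α => fhat (fam k u f c) α ^ 2) ⟨0, Finset.mem_univ _⟩
    exact ⟨α, fun β => h β (Finset.mem_univ β)⟩
  choose a ha using hex
  set E : ℕ → ℝ := fun c => l2Inner (fam k u f c) (fam k u f c) with hE
  set m : ℕ → ℝ := fun c => fhat (fam k u f c) (a c) ^ 2 with hm
  have hm0 : ∀ c, 0 ≤ m c := fun c => sq_nonneg _
  have hmE : ∀ c, m c ≤ E c := by
    intro c
    simp only [hE, hm, ← parseval]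
    exact Finset.single_le_sum (f := fun α => fhat (fam k u f c) α ^ 2)
      (fun _ _ => sq_nonneg _) (Finset.mem_univ _)
  have hmm : ∀ c, ∑ α, fhat (fam k u f c) α ^ 4 ≤ m c * E c := by
    intro c
    simp only [hE, ← parseval, Finset.mul_sum]
    refine Finset.sum_le_sum fun α _ => ?_
    have : fhat (fam k u f c) α ^ 4 = fhat (fam k u f c) α ^ 2 * fhat (fam k u f c) α ^ 2 := by ring
    rw [this]
    exact mul_le_mul_of_nonneg_right (ha c α) (sq_nonneg _)
  have h1 : ∀ c, fam k u f c b ^ 2 ≤ m c + lam * ((fam k u f c b ^ 2 - E c) ^ 2)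
      + lam * (E c ^ 2 - ∑ α, fhat (fam k u f c) α ^ 4) + 1 / (2 * lam) := by
    intro c
    have i1 := le_sq_add hl (fam k u f c b ^ 2 - E c)
    have i2 := le_sq_add hl (E c - m c)
    -- From `∑ fhat ^ 4 ≤ m * E` the right-hand side is at least `E * (E - m)`, which is at least
    -- `(E - m) ^ 2` since `0 ≤ m ≤ E`.
    have i3 : (E c - m c) ^ 2 ≤ E c ^ 2 - ∑ α, fhat (fam k u f c) α ^ 4 := by
      nlinarith [hmm c, hm0 c, hmE c]
    have i4 := mul_le_mul_of_nonneg_left i3 hl.le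
    have i5 : 1 / (2 * lam) = 1 / (4 * lam) + 1 / (4 * lam) := by field_simp; norm_num
    rw [i5]; linarith
  have h2 : ∑ c ∈ S, m c ≤ T := by
    rw [← Finset.sum_filter_add_sum_filter_not S (fun c => m c ≠ 0)]
    have hz : ∑ c ∈ S.filter (fun c => ¬ m c ≠ 0), m c = 0 :=
      Finset.sum_eq_zero fun c hc => by simpa using (Finset.mem_filter.1 hc).2
    rw [hz, add_zero]
    have hb : ∀ c ∈ S.filter (fun c => m c ≠ 0), c = bucket k u (a c) ∧ m c = fhat f (a c) ^ 2 := by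
      intro c hc
      obtain ⟨hc1, hc2⟩ := Finset.mem_filter.1 hc
      simp only [hm] at hc2 ⊢
      rw [fhat_fam _ _ _ _ (Finset.mem_range.1 (hS hc1))] at hc2 ⊢
      split_ifs at hc2 ⊢ with h
      · exact ⟨h, rfl⟩
      · simp at hc2
    -- A non-zero maximal coefficient lies in its own bucket, so the frequency determines the
    -- bucket.
    have hinj : Set.InjOn a (S.filter (fun c => m c ≠ 0) : Finset ℕ) := by
      intro c hc c' hc' h
      rw [(hb c hc).1, (hb c' hc').1, h]
    rw [Finset.sum_congr rfl fun c hc => (hb c hc).2,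
      ← Finset.sum_image (f := fun α => fhat f α ^ 2) hinj]
    exact hT _ (Finset.card_image_le.trans ((Finset.card_filter_le _ _).trans hs))
  have h3 : ∑ c ∈ S, (lam * ((fam k u f c b ^ 2 - E c) ^ 2)
      + lam * (E c ^ 2 - ∑ α, fhat (fam k u f c) α ^ 4)) ≤ lam * runError f k u b := by
    calc _ ≤ ∑ c ∈ Finset.range (2 ^ k), (lam * ((fam k u f c b ^ 2 - E c) ^ 2)
      + lam * (E c ^ 2 - ∑ α, fhat (fam k u f c) α ^ 4)) := by
          refine Finset.sum_le_sum_of_subset_of_nonneg hS fun c _ _ => ?_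
          have : 0 ≤ E c ^ 2 - ∑ α, fhat (fam k u f c) α ^ 4 :=
            sub_nonneg.2 (sum_pow_four_le _)
          positivity
      _ = _ := by
          rw [Finset.sum_add_distrib, ← Finset.mul_sum, ← Finset.mul_sum, Finset.sum_sub_distrib,
            sum_fhat_fam_pow _ _ _ 4 (by norm_num), runError]
          ring
  have h4 : ∑ _c ∈ S, 1 / (2 * lam) ≤ s / (2 * lam) := by
    rw [Finset.sum_const, nsmul_eq_mul, mul_one_div]
    have : (S.card : ℝ) ≤ s := by exact_mod_cast hs
    gcongr
  calc _ ≤ ∑ c ∈ S, (m c + lam * ((fam k u f c b ^ 2 - E c) ^ 2)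
      + lam * (E c ^ 2 - ∑ α, fhat (fam k u f c) α ^ 4) + 1 / (2 * lam)) :=
        Finset.sum_le_sum fun c _ => h1 c
    _ = ∑ c ∈ S, m c + ∑ c ∈ S, (lam * ((fam k u f c b ^ 2 - E c) ^ 2)
      + lam * (E c ^ 2 - ∑ α, fhat (fam k u f c) α ^ 4)) + ∑ _c ∈ S, 1 / (2 * lam) := by
        simp only [Finset.sum_add_distrib]; ring
    _ ≤ _ := by linarith

/-- The buckets hit by `A` number at most `s` and contain all the energy of `A`. Collisions can only
add energy here, so only the deviation term of `runError` matters. -/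
theorem exists_sum_buckets_ge {n : ℕ} (f : Vec n → ℝ) (k : ℕ) (u : Fin k → Vec n) (b : Vec n)
    {s : ℕ} {lam : ℝ} (hl : 0 < lam) {A : Finset (Vec n)} (hA : A.card ≤ s) :
    ∃ S ⊆ Finset.range (2 ^ k), S.card ≤ s ∧
      ∑ α ∈ A, fhat f α ^ 2
        ≤ ∑ c ∈ S, fam k u f c b ^ 2 + lam * runError f k u b + s / (2 * lam) := by
  classical
  set E : ℕ → ℝ := fun c => l2Inner (fam k u f c) (fam k u f c) with hE
  have hsub : A.image (bucket k u) ⊆ Finset.range (2 ^ k) := by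
    intro c hc
    obtain ⟨α, -, rfl⟩ := Finset.mem_image.1 hc
    exact Finset.mem_range.2 (bucket_lt k u α)
  have hcard : (A.image (bucket k u)).card ≤ s := Finset.card_image_le.trans hA
  refine ⟨A.image (bucket k u), hsub, hcard, ?_⟩
  have h1 : ∑ α ∈ A, fhat f α ^ 2 ≤ ∑ c ∈ A.image (bucket k u), E c := by
    rw [← Finset.sum_fiberwise_of_maps_to (t := A.image (bucket k u)) (g := bucket k u)
      fun α hα => Finset.mem_image_of_mem _ hα]
    refine Finset.sum_le_sum fun c hc => ?_
    simp only [hE, ← parseval]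
    calc _ = ∑ α ∈ A.filter (fun α => bucket k u α = c), fhat (fam k u f c) α ^ 2 := by
          refine Finset.sum_congr rfl fun α hα => ?_
          rw [fhat_fam _ _ _ _ (Finset.mem_range.1 (hsub hc)),
            if_pos (Finset.mem_filter.1 hα).2.symm]
      _ ≤ _ := Finset.sum_le_sum_of_subset_of_nonneg (Finset.subset_univ _)
          fun _ _ _ => sq_nonneg _
  have h2 : ∀ c, E c ≤ fam k u f c b ^ 2 + lam * (fam k u f c b ^ 2 - E c) ^ 2
      + 1 / (4 * lam) := by
    intro c
    have := le_sq_add hl (E c - fam k u f c b ^ 2)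
    have e : (E c - fam k u f c b ^ 2) ^ 2 = (fam k u f c b ^ 2 - E c) ^ 2 := by ring
    rw [e] at this
    linarith
  have h3 : ∑ c ∈ A.image (bucket k u), lam * (fam k u f c b ^ 2 - E c) ^ 2
      ≤ lam * runError f k u b := by
    rw [← Finset.mul_sum]
    refine mul_le_mul_of_nonneg_left ?_ hl.le
    have i1 : ∑ c ∈ A.image (bucket k u), (fam k u f c b ^ 2 - E c) ^ 2
        ≤ ∑ c ∈ Finset.range (2 ^ k), (fam k u f c b ^ 2 - E c) ^ 2 :=
      Finset.sum_le_sum_of_subset_of_nonneg hsub fun _ _ _ => sq_nonneg _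
    have i2 : ∑ α, fhat f α ^ 4 ≤ ∑ c ∈ Finset.range (2 ^ k), E c ^ 2 := by
      rw [← sum_fhat_fam_pow k u f 4 (by norm_num)]
      exact Finset.sum_le_sum fun c _ => sum_pow_four_le _
    rw [runError]
    linarith
  have h4 : ∑ _c ∈ A.image (bucket k u), 1 / (4 * lam) ≤ s / (2 * lam) := by
    rw [Finset.sum_const, nsmul_eq_mul, mul_one_div]
    have : ((A.image (bucket k u)).card : ℝ) ≤ s := by exact_mod_cast hcard
    gcongr
    norm_num
  calc _ ≤ _ := h1
    _ ≤ ∑ c ∈ A.image (bucket k u), (fam k u f c b ^ 2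
      + lam * (fam k u f c b ^ 2 - E c) ^ 2 + 1 / (4 * lam)) :=
        Finset.sum_le_sum fun c _ => h2 c
    _ ≤ _ := by
        simp only [Finset.sum_add_distrib]; linarith

/-! ## The thresholded sum -/

/-- The number of entries above a threshold. -/
def countGt (W : ℕ → ℝ) (B : ℕ) (τ : ℝ) : ℕ := ((Finset.range B).filter fun c => τ < W c).card

/-- The linear programming upper bound on the sum of the top `s` entries. -/
def topBound (W : ℕ → ℝ) (B s : ℕ) (τ : ℝ) : ℝ :=
  s * τ + ∑ c ∈ Finset.range B, if τ < W c then W c - τ else 0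

/-- Weak duality: `W c ≤ τ + max (W c - τ) 0`, summed over at most `s` indices; any non-negative
threshold is feasible. -/
theorem sum_le_topBound (W : ℕ → ℝ) (B s : ℕ) {τ : ℝ} (hτ : 0 ≤ τ) {S : Finset ℕ}
    (hS : S ⊆ Finset.range B) (hs : S.card ≤ s) : ∑ c ∈ S, W c ≤ topBound W B s τ := by
  have h1 : ∑ c ∈ S, W c ≤ ∑ c ∈ S, (τ + if τ < W c then W c - τ else 0) :=
    Finset.sum_le_sum fun c _ => by split_ifs with h <;> linarith
  have h2 : ∑ c ∈ S, (if τ < W c then W c - τ else 0)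
      ≤ ∑ c ∈ Finset.range B, if τ < W c then W c - τ else 0 :=
    Finset.sum_le_sum_of_subset_of_nonneg hS fun c _ _ => by split_ifs with h <;> linarith
  have h3 : (S.card : ℝ) * τ ≤ s * τ := by
    have : (S.card : ℝ) ≤ s := by exact_mod_cast hs
    gcongr
  rw [Finset.sum_add_distrib, Finset.sum_const, nsmul_eq_mul] at h1
  rw [topBound]; linarith

/-- Near complementary slackness: all entries above `lo + g` are taken, and the remaining places are
filled with entries above `lo`, each of which falls short of the threshold by at most `g`. If `lo =
0`, unfilled places cost at most `g` each. -/
theorem topBound_le (W : ℕ → ℝ) (B s : ℕ) {lo g : ℝ} (hg : 0 ≤ g)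
    (hcount : countGt W B (lo + g) ≤ s) (hlo : lo = 0 ∨ s < countGt W B lo) :
    ∃ S ⊆ Finset.range B, S.card ≤ s ∧ topBound W B s (lo + g) ≤ ∑ c ∈ S, W c + s * g := by
  classical
  set G := (Finset.range B).filter fun c => lo + g < W c with hG
  have hsumG : ∑ c ∈ Finset.range B, (if lo + g < W c then W c - (lo + g) else 0)
      = ∑ c ∈ G, W c - G.card * (lo + g) := by
    rw [← Finset.sum_filter, Finset.sum_sub_distrib, Finset.sum_const, nsmul_eq_mul]
  have hGs : G.card ≤ s := hcount
  have hGsR : (G.card : ℝ) ≤ s := by exact_mod_cast hGs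
  rcases hlo with rfl | hlo
  · refine ⟨G, Finset.filter_subset _ _, hGs, ?_⟩
    rw [topBound, hsumG]
    have : 0 ≤ (G.card : ℝ) * g := by positivity
    linarith
  · obtain ⟨S, hGS, hSL, hS⟩ := Finset.exists_subsuperset_card_eq
      (s := G) (t := (Finset.range B).filter fun c => lo < W c) (n := s)
      (by
        intro c hc
        obtain ⟨h1, h2⟩ := Finset.mem_filter.1 hc
        exact Finset.mem_filter.2 ⟨h1, by linarith⟩) hGs hlo.le
    refine ⟨S, hSL.trans (Finset.filter_subset _ _), hS.le, ?_⟩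
    rw [topBound, hsumG]
    have h1 : ∑ c ∈ S \ G, lo ≤ ∑ c ∈ S \ G, W c :=
      Finset.sum_le_sum fun c hc => (Finset.mem_filter.1 (hSL (Finset.sdiff_subset hc))).2.le
    have h2 : ∑ c ∈ S \ G, W c + ∑ c ∈ G, W c = ∑ c ∈ S, W c := Finset.sum_sdiff hGS
    have h3 : ((S \ G).card : ℝ) = s - G.card := by
      rw [Finset.card_sdiff_of_subset hGS, hS, Nat.cast_sub hGs]
    rw [Finset.sum_const, nsmul_eq_mul, h3] at h1
    have h4 : 0 ≤ (G.card : ℝ) * g := by positivity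
    nlinarith

/-! ## Truncation -/

/-- The function `f` with its large values replaced by zero. -/
def trunc {n : ℕ} (f : Vec n → ℝ) (B : ℝ) (x : Vec n) : ℝ := if f x * f x < B then f x else 0

theorem l2Inner_trunc_le {n : ℕ} (f : Vec n → ℝ) (B : ℝ) :
    l2Inner (trunc f B) (trunc f B) ≤ l2Inner f f := by
  simp only [l2Inner]
  refine div_le_div_of_nonneg_right (Finset.sum_le_sum fun x _ => ?_) (by positivity)
  simp only [trunc]
  split_ifs with h
  · exact le_rfl
  · rw [mul_zero]; exact mul_self_nonneg _

theorem m4_trunc_le {n : ℕ} (f : Vec n → ℝ) {B : ℝ} (hB : 0 ≤ B) (hf : l2Inner f f ≤ 1) :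
    m4 (trunc f B) ≤ B := by
  calc m4 (trunc f B) ≤ B * l2Inner f f := by
        rw [m4, l2Inner, ← mul_div_assoc, Finset.mul_sum]
        gcongr with x
        simp only [trunc]
        split_ifs with h
        · have : f x ^ 4 = (f x * f x) * (f x * f x) := by ring
          rw [this]
          exact mul_le_mul_of_nonneg_right h.le (mul_self_nonneg _)
        · rw [zero_pow (by norm_num)]
          exact mul_nonneg hB (mul_self_nonneg _)
    _ ≤ B := by nlinarith [l2Inner_self_nonneg f]

/-- Where a value is removed, `|f x| ≤ f x ^ 2 / √B`, so the removed part has `L¹` norm at most `1 /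
√B`. -/
theorem fhat_sub_trunc_sq_le {n : ℕ} (f : Vec n → ℝ) {B : ℝ} (hB : 0 < B) (hf : l2Inner f f ≤ 1)
    (α : Vec n) : (fhat f α - fhat (trunc f B) α) ^ 2 ≤ 1 / B := by
  have hr : 0 < Real.sqrt B := Real.sqrt_pos.2 hB
  have h1 : |fhat f α - fhat (trunc f B) α| ≤ 1 / Real.sqrt B := by
    rw [← fhat_sub, fhat, l2Inner, abs_div, abs_of_pos (by positivity : (0 : ℝ) < 2 ^ n)]
    calc _ ≤ (∑ x, f x * f x / Real.sqrt B) / 2 ^ n := by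
          gcongr
          refine (Finset.abs_sum_le_sum_abs _ _).trans (Finset.sum_le_sum fun x _ => ?_)
          have hc : |chi α x| = 1 := by
            rcases chi_eq_or α x with h | h <;> rw [h] <;> simp
          rw [abs_mul, hc, mul_one, Pi.sub_apply, trunc]
          split_ifs with h
          · rw [sub_self, abs_zero]
            exact div_nonneg (mul_self_nonneg _) hr.le
          · rw [sub_zero, le_div_iff₀ hr, ← abs_mul_abs_self]
            refine mul_le_mul_of_nonneg_left ?_ (abs_nonneg _)
            rw [← Real.sqrt_sq_eq_abs]
            exact Real.sqrt_le_sqrt (by rw [sq]; exact not_lt.1 h)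
      _ = l2Inner f f / Real.sqrt B := by
          rw [← Finset.sum_div, l2Inner, div_right_comm]
      _ ≤ _ := by gcongr
  calc _ = |fhat f α - fhat (trunc f B) α| ^ 2 := (sq_abs _).symm
    _ ≤ (1 / Real.sqrt B) ^ 2 := by gcongr
    _ = 1 / B := by rw [div_pow, Real.sq_sqrt hB.le, one_pow]

/-- The factorisation `x ^ 2 - y ^ 2 = (x - y) * (x + y)` and the inequality of arithmetic and
geometric means with weight `γ` separate the uniformly small difference from the sum, whose square
is controlled by the total energy. -/
theorem abs_sum_trunc_sub_le {n : ℕ} (f : Vec n → ℝ) {B γ : ℝ} (hB : 0 < B) (hγ : 0 < γ)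
    (hf : l2Inner f f ≤ 1) {s : ℕ} {A : Finset (Vec n)} (hA : A.card ≤ s) :
    |∑ α ∈ A, fhat (trunc f B) α ^ 2 - ∑ α ∈ A, fhat f α ^ 2| ≤ s / (2 * γ * B) + 2 * γ := by
  rw [← Finset.sum_sub_distrib]
  refine (Finset.abs_sum_le_sum_abs _ _).trans ?_
  have h1 : ∀ α, |fhat (trunc f B) α ^ 2 - fhat f α ^ 2|
      ≤ 1 / (2 * γ * B) + γ * (fhat (trunc f B) α ^ 2 + fhat f α ^ 2) := by
    intro α
    set x := fhat (trunc f B) α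
    set y := fhat f α
    have h2 : (y - x) ^ 2 ≤ 1 / B := fhat_sub_trunc_sq_le f hB hf α
    have h3 : |x ^ 2 - y ^ 2| ≤ (y - x) ^ 2 / (2 * γ) + γ * (x + y) ^ 2 / 2 := by
      have e : x ^ 2 - y ^ 2 = (x - y) * (x + y) := by ring
      rw [e, abs_le]
      constructor
      · have : (y - x) ^ 2 / (2 * γ) + γ * (x + y) ^ 2 / 2 + (x - y) * (x + y)
          = ((x - y) + γ * (x + y)) ^ 2 / (2 * γ) := by field_simp; ring
        have h5 : 0 ≤ ((x - y) + γ * (x + y)) ^ 2 / (2 * γ) := by positivity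
        linarith
      · have : (y - x) ^ 2 / (2 * γ) + γ * (x + y) ^ 2 / 2 - (x - y) * (x + y)
          = ((x - y) - γ * (x + y)) ^ 2 / (2 * γ) := by field_simp; ring
        have h5 : 0 ≤ ((x - y) - γ * (x + y)) ^ 2 / (2 * γ) := by positivity
        linarith
    have h4 : (y - x) ^ 2 / (2 * γ) ≤ 1 / (2 * γ * B) := by
      calc _ ≤ 1 / B / (2 * γ) := by gcongr
        _ = _ := by rw [div_div, mul_comm B]
    have h5 : (x + y) ^ 2 ≤ 2 * (x ^ 2 + y ^ 2) := by nlinarith [sq_nonneg (x - y)]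
    nlinarith
  have h6 : ∀ g : Vec n → ℝ, l2Inner g g ≤ 1 → ∑ α ∈ A, fhat g α ^ 2 ≤ 1 := by
    intro g hg
    rw [← parseval] at hg
    exact (Finset.sum_le_sum_of_subset_of_nonneg (Finset.subset_univ _)
      fun _ _ _ => sq_nonneg _).trans hg
  have h7 := h6 f hf
  have h8 := h6 (trunc f B) ((l2Inner_trunc_le f B).trans hf)
  have h9 : (A.card : ℝ) * (1 / (2 * γ * B)) ≤ s / (2 * γ * B) := by
    rw [mul_one_div]
    have : (A.card : ℝ) ≤ s := by exact_mod_cast hA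
    gcongr
  refine (Finset.sum_le_sum fun α _ => h1 α).trans ?_
  rw [Finset.sum_add_distrib, Finset.sum_const, nsmul_eq_mul, ← Finset.mul_sum,
    Finset.sum_add_distrib]
  nlinarith

/-- The error of one run, in terms of `runError`. -/
theorem abs_topBound_sub_le {n : ℕ} (f : Vec n → ℝ) (hf : l2Inner f f ≤ 1) (k : ℕ)
    (u : Fin k → Vec n) (b : Vec n) {s : ℕ} {lam γ lo g : ℝ} (hl : 0 < lam) (hγ : 0 < γ)
    (hlo0 : 0 ≤ lo) (hg : 0 ≤ g) {A : Finset (Vec n)} (hA : A.card ≤ s)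
    (hmax : ∀ A' : Finset (Vec n), A'.card ≤ s → ∑ α ∈ A', fhat f α ^ 2 ≤ ∑ α ∈ A, fhat f α ^ 2)
    {W : ℕ → ℝ} (hW : ∀ c < 2 ^ k, W c = fam k u (trunc f (2 ^ k)) c b ^ 2)
    (hcount : countGt W (2 ^ k) (lo + g) ≤ s) (hlo : lo = 0 ∨ s < countGt W (2 ^ k) lo) :
    |topBound W (2 ^ k) s (lo + g) - ∑ α ∈ A, fhat f α ^ 2|
      ≤ lam * runError (trunc f (2 ^ k)) k u b + s / (2 * lam) + s * g
        + (s / (2 * γ * 2 ^ k) + 2 * γ) := by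
  have hB : (0 : ℝ) < 2 ^ k := by positivity
  have hWS : ∀ S ⊆ Finset.range (2 ^ k), ∑ c ∈ S, W c
      = ∑ c ∈ S, fam k u (trunc f (2 ^ k)) c b ^ 2 := fun S hS =>
    Finset.sum_congr rfl fun c hc => hW c (Finset.mem_range.1 (hS hc))
  rw [abs_le]
  constructor
  · obtain ⟨S, hS, hs, h⟩ := exists_sum_buckets_ge (trunc f (2 ^ k)) k u b hl hA
    rw [← hWS S hS] at h
    have h2 := sum_le_topBound W (2 ^ k) s (add_nonneg hlo0 hg) hS hs
    have h3 := (abs_le.1 (abs_sum_trunc_sub_le f hB hγ hf hA)).1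
    have h4 : 0 ≤ s * g := by positivity
    linarith
  · obtain ⟨S, hS, hs, h⟩ := topBound_le W (2 ^ k) s hg hcount hlo
    rw [hWS S hS] at h
    have h2 := sum_buckets_le (trunc f (2 ^ k)) k u b (s := s)
      -- The coefficients in the buckets are those of the truncation, so the bound for `f` is
      -- enlarged by the truncation loss.
      (T := ∑ α ∈ A, fhat f α ^ 2 + (s / (2 * γ * 2 ^ k) + 2 * γ)) hl
      (fun A' hA' => by
        have h3 := (abs_le.1 (abs_sum_trunc_sub_le f hB hγ hf hA')).2
        linarith [hmax A' hA']) hS hs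
    linarith

/-! ## Total correctness of programs -/

/-- The program terminates from the state `σ`, in a state that satisfies `Q`. -/
def WP {n : ℕ} (f : Vec n → ℝ) (ω : ℕ → Vec n) (p : Prog) (Q : State n → Prop) (σ : State n) :
    Prop := ∃ τ, Exec f ω p σ τ ∧ Q τ

/-- A block of instructions. -/
def blk : List Instr → Prog
  | [] => .skip
  | i :: l => .seq (.op i) (blk l)

section WP

variable {n : ℕ} {f : Vec n → ℝ} {ω : ℕ → Vec n}

theorem WP.mono {p : Prog} {Q R : State n → Prop} {σ : State n} (h : WP f ω p Q σ)
    (hQR : ∀ σ', Q σ' → R σ') : WP f ω p R σ :=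
  let ⟨σ', h1, h2⟩ := h
  ⟨σ', h1, hQR σ' h2⟩

theorem WP.skip {Q : State n → Prop} {σ : State n} (h : Q σ) : WP f ω .skip Q σ :=
  ⟨σ, .skip σ, h⟩

theorem WP.op {i : Instr} {Q : State n → Prop} {σ : State n} (h : Q (i.effect f ω σ).tick) :
    WP f ω (.op i) Q σ := ⟨_, .op i σ, h⟩

theorem WP.seq {p q : Prog} {Q : State n → Prop} {σ : State n}
    (h : WP f ω p (WP f ω q Q) σ) : WP f ω (.seq p q) Q σ :=
  let ⟨_, h1, σ₂, h2, h3⟩ := h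
  ⟨σ₂, .seq h1 h2, h3⟩

theorem WP.ite {c : Cond} {p q : Prog} {Q : State n → Prop} {σ : State n}
    (h1 : c.holds σ → WP f ω p Q σ.tick) (h2 : ¬ c.holds σ → WP f ω q Q σ.tick) :
    WP f ω (.ite c p q) Q σ := by
  by_cases h : c.holds σ
  · obtain ⟨σ', h3, h4⟩ := h1 h
    exact ⟨σ', .iteTrue h h3, h4⟩
  · obtain ⟨σ', h3, h4⟩ := h2 h
    exact ⟨σ', .iteFalse h h3, h4⟩

/-- The invariant is indexed by the number of completed iterations and must force the test to hold
exactly `K` times. Termination is thus part of the conclusion, and a time bound can be an ordinary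
clause of the invariant. -/
theorem WP.loop {c : Cond} {p : Prog} {Q : State n → Prop} (I : ℕ → State n → Prop) (K : ℕ)
    {σ : State n} (h0 : I 0 σ)
    (hstep : ∀ k < K, ∀ τ, I k τ → c.holds τ ∧ WP f ω p (I (k + 1)) τ.tick)
    (hend : ∀ τ, I K τ → ¬ c.holds τ ∧ Q τ.tick) : WP f ω (.loop c p) Q σ := by
  have key : ∀ m k, k + m = K → ∀ τ, I k τ → WP f ω (.loop c p) Q τ := by
    intro m
    induction m with
    | zero =>
      rintro k rfl τ hτ
      obtain ⟨h1, h2⟩ := hend τ hτ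
      exact ⟨τ.tick, .loopFalse h1, h2⟩
    | succ m ih =>
      intro k hk τ hτ
      obtain ⟨h1, τ', h2, h3⟩ := hstep k (by omega) τ hτ
      obtain ⟨τ'', h4, h5⟩ := ih (k + 1) (by omega) τ' h3
      exact ⟨τ'', .loopTrue h1 h2 h4, h5⟩
  exact key K 0 (by omega) σ h0

theorem WP.nil {Q : State n → Prop} {σ : State n} (h : Q σ) : WP f ω (blk []) Q σ := WP.skip h

theorem WP.cons {i : Instr} {l : List Instr} {Q : State n → Prop} {σ : State n}
    (h : WP f ω (blk l) Q (i.effect f ω σ).tick) : WP f ω (blk (i :: l)) Q σ :=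
  WP.seq (WP.op h)

end WP

/-! ## The program -/

section Programs

open Addr Instr Cond

/-- Double the list of points by adding a random vector to each. -/
def genLevel : Prog :=
  .seq (blk [vrand (dir 0), ncopy (dir 8) (dir 7), ncopy (dir 6) (dir 3)])
    (.loop (nlt (dir 6) (dir 8)) (blk [vadd (ind 7) (ind 6) (dir 0),
      nadd (dir 6) (dir 6) (dir 3), nadd (dir 7) (dir 7) (dir 3)]))

/-- Generate a random affine image of a cube. -/
def genProg : Prog :=
  .seq (blk [vrand (dir 1), nadd (dir 7) (dir 3) (dir 3)])
    (.loop (nlt (dir 7) (dir 9)) genLevel)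

/-- Query all points and truncate the values. -/
def queryProg : Prog :=
  .seq (blk [ncopy (dir 6) (dir 3), nconst (dir 10) 32])
    (.loop (nlt (dir 6) (dir 9))
      (.seq (blk [query (dir 20) (ind 6), rmul (dir 9) (dir 20) (dir 20)])
        (.seq (.ite (rlt (dir 9) (dir 4)) (.op (rcopy (ind 10) (dir 20)))
          (.op (rconst (ind 10) 0)))
          (blk [nadd (dir 6) (dir 6) (dir 3), nadd (dir 10) (dir 10) (dir 3)]))))

/-- One round of the Walsh–Hadamard transform. -/
def roundProg : Prog :=
  .seq (.op (nconst (dir 14) 0))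
    (.seq (.loop (nlt (dir 14) (dir 4)) (blk [
      radd (dir 21) (ind 11) (ind 12), rmul (dir 21) (dir 21) (dir 2), rcopy (ind 10) (dir 21),
      nadd (dir 10) (dir 10) (dir 3),
      rsub (dir 21) (ind 11) (ind 12), rmul (dir 21) (dir 21) (dir 2), rcopy (ind 10) (dir 21),
      nadd (dir 10) (dir 10) (dir 3),
      nadd (dir 11) (dir 11) (dir 3), nadd (dir 12) (dir 12) (dir 3),
      nadd (dir 14) (dir 14) (dir 3)]))
      (blk [nadd (dir 11) (dir 11) (dir 4), nadd (dir 12) (dir 12) (dir 4),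
        nadd (dir 13) (dir 13) (dir 13)]))

/-- The Walsh–Hadamard transform. -/
def transformProg : Prog :=
  .seq (blk [nconst (dir 11) 32, nadd (dir 12) (dir 11) (dir 4), ncopy (dir 13) (dir 3)])
    (.loop (nlt (dir 13) (dir 2)) roundProg)

/-- Count the squares above a threshold. -/
def countProg : Prog :=
  .seq (blk [nconst (dir 16) 0, ncopy (dir 6) (dir 11)])
    (.loop (nlt (dir 6) (dir 10))
      (.seq (.op (rmul (dir 27) (ind 6) (ind 6)))
        (.seq (.ite (rlt (dir 26) (dir 27)) (.op (nadd (dir 16) (dir 16) (dir 3))) .skip)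
          (.op (nadd (dir 6) (dir 6) (dir 3))))))

/-- Find a threshold with about `s` squares above it by bisection. -/
def bisectProg : Prog :=
  .seq (blk [rconst (dir 22) 0, rcopy (dir 23) (dir 4)])
    (.loop (rlt (dir 24) (dir 23))
      (.seq (blk [rmul (dir 23) (dir 23) (dir 2), radd (dir 26) (dir 22) (dir 23)])
        (.seq countProg
          (.ite (nlt (dir 1) (dir 16)) (.op (rcopy (dir 22) (dir 26))) .skip))))

/-- Compute the estimate of the energy from the threshold. -/
def sumProg : Prog :=
  .seq (blk [radd (dir 26) (dir 22) (dir 23), rmul (dir 28) (dir 12) (dir 26),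
      ncopy (dir 6) (dir 11)])
    (.seq (.loop (nlt (dir 6) (dir 10))
      (.seq (.op (rmul (dir 27) (ind 6) (ind 6)))
        (.seq (.ite (rlt (dir 26) (dir 27))
            (blk [radd (dir 28) (dir 28) (dir 27), rsub (dir 28) (dir 28) (dir 26)]) .skip)
          (.op (nadd (dir 6) (dir 6) (dir 3))))))
      (.ite (rlt (dir 11) (dir 28)) (.op (rcopy (dir 28) (dir 11))) .skip))

/-- One run: an estimate of the energy of the top coefficients, added to the accumulator. -/
def runProg : Prog :=
  .seq genProg (.seq queryProg (.seq transformProg (.seq bisectProg (.seq sumProg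
    (blk [radd (dir 8) (dir 8) (dir 28), radd (dir 7) (dir 7) (dir 11)])))))

/-- The computation of the parameters. -/
def setupProg : Prog :=
  .seq (blk [nconst (dir 3) 1, nconst (dir 2) 1, rconst (dir 4) 1, rconst (dir 11) 1,
      rofNat (dir 12) (dir 1), rmul (dir 20) (dir 0) (dir 0), rdiv (dir 3) (dir 12) (dir 20),
      rconst (dir 21) 1024, rmul (dir 3) (dir 3) (dir 21), rconst (dir 21) 2,
      rdiv (dir 10) (dir 21) (dir 20), rconst (dir 21) 16, rmul (dir 24) (dir 12) (dir 21),
      rdiv (dir 24) (dir 0) (dir 24), rconst (dir 6) 1])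
    (.seq (.loop (rlt (dir 4) (dir 3))
        (blk [ncopy (dir 4) (dir 2), nadd (dir 2) (dir 2) (dir 2), radd (dir 4) (dir 4) (dir 4)]))
      (.seq (.loop (rlt (dir 1) (dir 6))
          (blk [rmul (dir 6) (dir 6) (dir 2), radd (dir 5) (dir 5) (dir 10)]))
        (.op (nadd (dir 9) (dir 2) (dir 3)))))

/-- The estimation algorithm. -/
def estimateProg : Prog :=
  .seq (.op (rconst (dir 2) (1 / 2)))
    (.ite (rlt (dir 0) (dir 2))
      (.seq setupProg (.seq (.loop (rlt (dir 7) (dir 5)) runProg)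
        (blk [rdiv (dir 8) (dir 8) (dir 7), rsub (dir 0) (dir 11) (dir 8)])))
      (.op (rcopy (dir 0) (dir 2))))

-- Correctness and running time of the subroutines

attribute [local simp] Instr.effect State.setN State.setR State.setV State.getN State.getR
  State.getV Addr.loc State.tick Function.update_apply Cond.holds

variable {n : ℕ} {f : Vec n → ℝ} {ω : ℕ → Vec n}

/-- The points of the random affine cube given by the vectors `w`. -/
def pts (w : ℕ → Vec n) : ℕ → ℕ → Vec n
  | 0, _ => w 0
  | k + 1, i => if i < 2 ^ k then pts w k i else pts w k (i - 2 ^ k) + w (k + 1)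

/-- Vector cell `0` holds the new direction and the points start at cell `1`. Natural-number cells
`6`, `7` and `8` are the read pointer, the write pointer and the fixed end of the old list. -/
theorem wp_genLevel (σ₀ : State n) (w : ℕ → Vec n) (k : ℕ) (h3 : σ₀.nat 3 = 1)
    (h7 : σ₀.nat 7 = 1 + 2 ^ k) (hw : ω σ₀.used = w (k + 1))
    (hvec : ∀ i < 2 ^ k, σ₀.vec (1 + i) = pts w k i) :
    WP f ω genLevel (fun σ => σ.real = σ₀.real ∧ σ.asked = σ₀.asked ∧
      (∀ i, i ≠ 6 → i ≠ 7 → i ≠ 8 → σ.nat i = σ₀.nat i) ∧ σ.nat 7 = 1 + 2 ^ (k + 1) ∧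
      (∀ i < 2 ^ (k + 1), σ.vec (1 + i) = pts w (k + 1) i) ∧
      σ.used = σ₀.used + 1 ∧ σ.time ≤ σ₀.time + 4 + 4 * 2 ^ k) σ₀ := by
  refine WP.seq (WP.cons (WP.cons (WP.cons (WP.nil ?_))))
  refine WP.loop (fun j σ => σ.real = σ₀.real ∧ σ.asked = σ₀.asked ∧
      (∀ i, i ≠ 6 → i ≠ 7 → i ≠ 8 → σ.nat i = σ₀.nat i) ∧
      σ.nat 6 = 1 + j ∧ σ.nat 7 = 1 + 2 ^ k + j ∧ σ.nat 8 = 1 + 2 ^ k ∧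
      σ.vec 0 = w (k + 1) ∧
      (∀ i < 2 ^ k + j, σ.vec (1 + i) = pts w (k + 1) i) ∧
      σ.used = σ₀.used + 1 ∧ σ.time ≤ σ₀.time + 3 + 4 * j) (2 ^ k) ?_ ?_ ?_
  · refine ⟨rfl, rfl, ?_, ?_, ?_, ?_, ?_, ?_, rfl, ?_⟩
    · intro i h6 h7 h8; simp [h6, h8]
    · simp [h3]
    · simp [h7]
    · simp [h7]
    · simp [hw]
    · intro i hi
      simp only [add_zero] at hi
      simp [hvec i hi, pts, hi]
    · simp
  · rintro j hj τ ⟨i1, i2, i3, i4, i5, i6, i7, i8, i9, i10⟩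
    have e3 : τ.nat 3 = 1 := by rw [i3 3 (by decide) (by decide) (by decide), h3]
    refine ⟨by simp [i4, i6]; omega, WP.cons (WP.cons (WP.cons (WP.nil ?_)))⟩
    refine ⟨by simp [i1], by simp [i2], ?_, ?_, ?_, ?_, ?_, ?_, by simp [i9], ?_⟩
    · intro i h6 h7 h8; simp [h6, h7, i3 i h6 h7 h8]
    · simp [i4, e3]; omega
    · simp [i5, e3]; omega
    · simp [i6]
    · simp [i5, i7]
      omega
    · intro i hi
      by_cases h : i = 2 ^ k + j
      · have h1 : 1 + i = τ.nat 7 := by omega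
        simp [h1, i4, i7]
        rw [i8 j (by omega)]
        simp [pts, h, hj]
      · have h1 : 1 + i ≠ τ.nat 7 := by omega
        simp [h1, i8 i (by omega)]
    · simp; omega
  · rintro τ ⟨i1, i2, i3, i4, i5, i6, i7, i8, i9, i10⟩
    refine ⟨by simp [i4, i6], by simp [i1], by simp [i2], i3, ?_, ?_, by simp [i9], ?_⟩
    · simp [i5, pow_succ]; omega
    · intro i hi; rw [pow_succ] at hi; exact i8 i (by omega)
    · simp; omega

theorem wp_genProg (σ₀ : State n) (d : ℕ) (h3 : σ₀.nat 3 = 1) (h9 : σ₀.nat 9 = 2 ^ d + 1) :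
    WP f ω genProg (fun σ => σ.real = σ₀.real ∧ σ.asked = σ₀.asked ∧
      (∀ i, i ≠ 6 → i ≠ 7 → i ≠ 8 → σ.nat i = σ₀.nat i) ∧
      (∀ i < 2 ^ d, σ.vec (1 + i) = pts (fun i => ω (σ₀.used + i)) d i) ∧
      σ.used = σ₀.used + (d + 1) ∧ σ.time ≤ σ₀.time + 12 * 2 ^ d) σ₀ := by
  refine WP.seq (WP.cons (WP.cons (WP.nil ?_)))
  -- A level costs a multiple of the current length plus a constant; geometric growth absorbs this
  -- into `9 * 2 ^ k`.
  refine WP.loop (fun k σ => σ.real = σ₀.real ∧ σ.asked = σ₀.asked ∧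
      (∀ i, i ≠ 6 → i ≠ 7 → i ≠ 8 → σ.nat i = σ₀.nat i) ∧ σ.nat 7 = 1 + 2 ^ k ∧
      (∀ i < 2 ^ k, σ.vec (1 + i) = pts (fun i => ω (σ₀.used + i)) k i) ∧
      σ.used = σ₀.used + (k + 1) ∧ σ.time ≤ σ₀.time + 2 + 9 * 2 ^ k) d ?_ ?_ ?_
  · refine ⟨rfl, rfl, ?_, ?_, ?_, rfl, ?_⟩
    · intro i h6 h7 h8; simp [h7]
    · simp [h3]
    · intro i hi
      have : i = 0 := by simpa using hi
      simp [this, pts]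
    · simp
  · rintro k hk τ ⟨i1, i2, i3, i4, i5, i6, i7⟩
    have e3 : τ.nat 3 = 1 := by rw [i3 3 (by decide) (by decide) (by decide), h3]
    have e9 : τ.nat 9 = 2 ^ d + 1 := by rw [i3 9 (by decide) (by decide) (by decide), h9]
    have hlt : 2 ^ k < 2 ^ d := Nat.pow_lt_pow_right (by norm_num) hk
    refine ⟨by simp [i4, e9]; omega, ?_⟩
    refine (wp_genLevel τ.tick (fun i => ω (σ₀.used + i)) k e3 i4 (by simp [i6]) i5).mono ?_
    rintro σ ⟨j1, j2, j3, j4, j5, j6, j7⟩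
    refine ⟨j1.trans i1, j2.trans i2, fun i a b c => (j3 i a b c).trans (i3 i a b c), j4, j5,
      ?_, ?_⟩
    · rw [j6]; simp [i6]; omega
    · simp only [State.tick] at j7
      have : 1 ≤ 2 ^ k := Nat.one_le_two_pow
      rw [pow_succ]; omega
  · rintro τ ⟨i1, i2, i3, i4, i5, i6, i7⟩
    have e9 : τ.nat 9 = 2 ^ d + 1 := by rw [i3 9 (by decide) (by decide) (by decide), h9]
    have : 1 ≤ 2 ^ d := Nat.one_le_two_pow
    refine ⟨by simp [i4, e9, add_comm], i1, i2, i3, i5, i6, ?_⟩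
    simp; omega

/-- The list of the first `j` points, the latest first. -/
def pointList (P : ℕ → Vec n) : ℕ → List (Vec n)
  | 0 => []
  | j + 1 => P j :: pointList P j

theorem length_pointList (P : ℕ → Vec n) (j : ℕ) : (pointList P j).length = j := by
  induction j with
  | zero => rfl
  | succ j ih => simp [pointList, ih]

theorem pointList_congr {P P' : ℕ → Vec n} {j : ℕ} (h : ∀ i < j, P i = P' i) :
    pointList P j = pointList P' j := by
  induction j with
  | zero => rfl
  | succ j ih => simp only [pointList, h j (by omega), ih fun i hi => h i (by omega)]

/-- Real cells below `32` serve as registers and the data arrays start at `32`; cells `9` and `20`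
are scratch. Cell `9` among the naturals is one past the last point, because points are stored from
`1` on. -/
theorem wp_queryProg (σ₀ : State n) (B : ℕ) (h3 : σ₀.nat 3 = 1) (h9 : σ₀.nat 9 = B + 1) :
    WP f ω queryProg (fun σ => σ.vec = σ₀.vec ∧ σ.used = σ₀.used ∧
      (∀ i, i ≠ 6 → i ≠ 10 → σ.nat i = σ₀.nat i) ∧ σ.nat 10 = 32 + B ∧
      (∀ i < 32, i ≠ 9 → i ≠ 20 → σ.real i = σ₀.real i) ∧
      (∀ i < B, σ.real (32 + i) = trunc f (σ₀.real 4) (σ₀.vec (1 + i))) ∧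
      σ.asked = pointList (fun i => σ₀.vec (1 + i)) B ++ σ₀.asked ∧
      σ.time ≤ σ₀.time + 3 + 7 * B) σ₀ := by
  refine WP.seq (WP.cons (WP.cons (WP.nil ?_)))
  refine WP.loop (fun j σ => σ.vec = σ₀.vec ∧ σ.used = σ₀.used ∧
      (∀ i, i ≠ 6 → i ≠ 10 → σ.nat i = σ₀.nat i) ∧ σ.nat 6 = 1 + j ∧ σ.nat 10 = 32 + j ∧
      (∀ i < 32, i ≠ 9 → i ≠ 20 → σ.real i = σ₀.real i) ∧
      (∀ i < j, σ.real (32 + i) = trunc f (σ₀.real 4) (σ₀.vec (1 + i))) ∧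
      σ.asked = pointList (fun i => σ₀.vec (1 + i)) j ++ σ₀.asked ∧
      σ.time ≤ σ₀.time + 2 + 7 * j) B ?_ ?_ ?_
  · refine ⟨rfl, rfl, ?_, ?_, ?_, ?_, ?_, ?_, ?_⟩
    · intro i h6 h10; simp [h6, h10]
    · simp [h3]
    · simp
    · intro i h9 h20; simp
    · intro i hi; omega
    · simp [pointList]
    · simp
  · rintro j hj τ ⟨i1, i2, i3, i4, i5, i6, i7, i8, i9⟩
    have e3 : τ.nat 3 = 1 := by rw [i3 3 (by decide) (by decide), h3]
    have e9 : τ.nat 9 = B + 1 := by rw [i3 9 (by decide) (by decide), h9]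
    have e4 : τ.real 4 = σ₀.real 4 := i6 4 (by decide) (by decide) (by decide)
    refine ⟨by simp [i4, e9]; omega, WP.seq (WP.cons (WP.cons (WP.nil (WP.seq (WP.ite ?_ ?_)))))⟩
    · intro hc
      refine WP.op (WP.cons (WP.cons (WP.nil ?_)))
      refine ⟨by simp [i1], by simp [i2], ?_, ?_, ?_, ?_, ?_, ?_, ?_⟩
      · intro i h6 h10; simp [h6, h10, i3 i h6 h10]
      · simp [i4, e3]; omega
      · simp [i5, e3]; omega
      · intro i hi h9 h20
        have : i ≠ 32 + j := by omega
        simp [i5, this, h9, h20, i6 i hi h9 h20]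
      · intro i hi
        simp [i4, i1, e4] at hc
        by_cases h : i = j
        · subst h
          simp [i5, i1, i4, trunc, hc]
        · have h9 : 32 + i ≠ 9 := by omega
          have h20 : 32 + i ≠ 20 := by omega
          simp [i5, h, h9, h20, i7 i (by omega)]
      · simp [i8, i4, i1, pointList]
      · simp; omega
    · intro hc
      refine WP.op (WP.cons (WP.cons (WP.nil ?_)))
      refine ⟨by simp [i1], by simp [i2], ?_, ?_, ?_, ?_, ?_, ?_, ?_⟩
      · intro i h6 h10; simp [h6, h10, i3 i h6 h10]
      · simp [i4, e3]; omega
      · simp [i5, e3]; omega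
      · intro i hi h9 h20
        have : i ≠ 32 + j := by omega
        simp [i5, this, h9, h20, i6 i hi h9 h20]
      · intro i hi
        simp [i4, i1, e4] at hc
        by_cases h : i = j
        · subst h
          simp [i5, trunc, hc]
        · have h9 : 32 + i ≠ 9 := by omega
          have h20 : 32 + i ≠ 20 := by omega
          simp [i5, h, h9, h20, i7 i (by omega)]
      · simp [i8, i4, i1, pointList]
      · simp; omega
  · rintro τ ⟨i1, i2, i3, i4, i5, i6, i7, i8, i9⟩
    have e9 : τ.nat 9 = B + 1 := by rw [i3 9 (by decide) (by decide), h9]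
    refine ⟨by simp [i4, e9, add_comm], i1, i2, i3, i5, i6, i7, i8, ?_⟩
    simp; omega

/-- Cells at distance `h` are combined and the two results are written side by side to fresh memory.
The bounds `ha` and `hq` keep the writes away from the registers and from the data still to be read.
-/
theorem wp_roundProg (σ₀ : State n) (a h q m : ℕ) (h2 : σ₀.real 2 = 1 / 2) (h3 : σ₀.nat 3 = 1)
    (h4 : σ₀.nat 4 = h) (h10 : σ₀.nat 10 = q) (h11 : σ₀.nat 11 = a) (h12 : σ₀.nat 12 = a + h)
    (h13 : σ₀.nat 13 = m) (ha : 32 ≤ a) (hq : a + 2 * h ≤ q) :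
    WP f ω roundProg (fun σ => σ.vec = σ₀.vec ∧ σ.used = σ₀.used ∧ σ.asked = σ₀.asked ∧
      (∀ i < 10, σ.nat i = σ₀.nat i) ∧ σ.nat 10 = q + 2 * h ∧ σ.nat 11 = a + 2 * h ∧
      σ.nat 12 = a + 3 * h ∧ σ.nat 13 = 2 * m ∧
      (∀ i < q, i ≠ 21 → σ.real i = σ₀.real i) ∧
      (∀ i < h, σ.real (q + 2 * i) = (σ₀.real (a + i) + σ₀.real (a + h + i)) / 2 ∧
        σ.real (q + 2 * i + 1) = (σ₀.real (a + i) - σ₀.real (a + h + i)) / 2) ∧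
      σ.time ≤ σ₀.time + 5 + 12 * h) σ₀ := by
  refine WP.seq (WP.op (WP.seq ?_))
  refine WP.loop (fun j σ => σ.vec = σ₀.vec ∧ σ.used = σ₀.used ∧ σ.asked = σ₀.asked ∧
      (∀ i < 10, σ.nat i = σ₀.nat i) ∧ σ.nat 10 = q + 2 * j ∧ σ.nat 11 = a + j ∧
      σ.nat 12 = a + h + j ∧ σ.nat 13 = m ∧ σ.nat 14 = j ∧
      (∀ i < q, i ≠ 21 → σ.real i = σ₀.real i) ∧
      (∀ i < j, σ.real (q + 2 * i) = (σ₀.real (a + i) + σ₀.real (a + h + i)) / 2 ∧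
        σ.real (q + 2 * i + 1) = (σ₀.real (a + i) - σ₀.real (a + h + i)) / 2) ∧
      σ.time ≤ σ₀.time + 1 + 12 * j) h ?_ ?_ ?_
  · refine ⟨rfl, rfl, rfl, ?_, ?_, ?_, ?_, ?_, ?_, ?_, ?_, ?_⟩
    · intro i hi
      have : i ≠ 14 := by omega
      simp [this]
    · simp [h10]
    · simp [h11]
    · simp [h12]
    · simp [h13]
    · simp
    · intro i _ _; simp
    · intro i hi; omega
    · simp
  · rintro j hj τ ⟨i1, i2, i3, i4, i10, i11, i12, i13, i14, ir, ia, it⟩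
    have e3 : τ.nat 3 = 1 := by rw [i4 3 (by decide), h3]
    have e4 : τ.nat 4 = h := by rw [i4 4 (by decide), h4]
    have e2 : τ.real 2 = 1 / 2 := by rw [ir 2 (by omega) (by decide), h2]
    have ea : τ.real (a + j) = σ₀.real (a + j) := ir _ (by omega) (by omega)
    have eb : τ.real (a + h + j) = σ₀.real (a + h + j) := ir _ (by omega) (by omega)
    have n1 : a + j ≠ 21 := by omega
    have n2 : a + h + j ≠ 21 := by omega
    have n3 : (2 : ℕ) ≠ q + 2 * j := by omega
    have n4 : a + j ≠ q + 2 * j := by omega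
    have n5 : a + h + j ≠ q + 2 * j := by omega
    have n6 : q + 2 * j ≠ 21 := by omega
    refine ⟨by simp [i14, e4, hj], ?_⟩
    refine WP.cons (WP.cons (WP.cons (WP.cons (WP.cons (WP.cons (WP.cons (WP.cons (WP.cons
      (WP.cons (WP.cons (WP.nil ?_)))))))))))
    refine ⟨by simp [i1], by simp [i2], by simp [i3], ?_, ?_, ?_, ?_, ?_, ?_, ?_, ?_, ?_⟩
    · intro i hi
      have m1 : i ≠ 10 := by omega
      have m2 : i ≠ 11 := by omega
      have m3 : i ≠ 12 := by omega
      have m4 : i ≠ 14 := by omega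
      simp [m1, m2, m3, m4, i4 i hi]
    · simp [i10, e3]; omega
    · simp [i11, e3]; omega
    · simp [i12, e3]; omega
    · simp [i13]
    · simp [i14, e3]
    · intro i hi h21
      have m1 : i ≠ q + 2 * j := by omega
      have m2 : i ≠ q + 2 * j + 1 := by omega
      simp [i10, e3, m1, m2, h21, ir i hi h21]
    · intro i hi
      by_cases hij : i = j
      · subst hij
        simp [i10, i11, i12, e3, e2, n1, n2, n3, n4, n5, n6, ea, eb]
        constructor <;> ring
      · have m1 : i < j := by omega
        have m2 : q + 2 * i ≠ 21 := by omega
        have m3 : q + 2 * i + 1 ≠ 21 := by omega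
        have m4 : q + 2 * i ≠ q + 2 * j + 1 := by omega
        have m5 : q + 2 * i + 1 ≠ q + 2 * j := by omega
        have m6 : q + 2 * i ≠ q + 2 * j := by omega
        have m7 : q + 2 * i + 1 ≠ q + 2 * j + 1 := by omega
        obtain ⟨r1, r2⟩ := ia i m1
        constructor
        · simp [i10, i11, i12, e3, m2, m4, hij, r1]
        · simp [i10, i11, i12, e3, m3, m5, hij, r2]
    · simp; omega
  · rintro τ ⟨i1, i2, i3, i4, i10, i11, i12, i13, i14, ir, ia, it⟩
    have e4 : τ.nat 4 = h := by rw [i4 4 (by decide), h4]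
    refine ⟨by simp [i14, e4], ?_⟩
    refine WP.cons (WP.cons (WP.cons (WP.nil ?_)))
    refine ⟨by simp [i1], by simp [i2], by simp [i3], ?_, ?_, ?_, ?_, ?_, ?_, ?_, ?_⟩
    · intro i hi
      have m2 : i ≠ 11 := by omega
      have m3 : i ≠ 12 := by omega
      have m4 : i ≠ 13 := by omega
      simp [m2, m3, m4, i4 i hi]
    · simp [i10]
    · simp [i11, e4]; omega
    · simp [i12, e4]; omega
    · simp [i13]; omega
    · intro i hi h21; simp [ir i hi h21]
    · intro i hi; simpa using ia i hi
    · simp; omega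

/-- Pairing the two halves of the array eliminates the direction added last in `pts`. The directions
are therefore consumed in reverse order, which is why `fam` receives `w (d - i)`. -/
theorem wp_transformProg (σ₀ : State n) (d h : ℕ) (g : Vec n → ℝ) (w : ℕ → Vec n)
    (hd : 2 ^ d = 2 * h) (h2 : σ₀.real 2 = 1 / 2) (h3 : σ₀.nat 3 = 1)
    (h4 : σ₀.nat 4 = h) (hB : σ₀.nat 2 = 2 ^ d) (h10 : σ₀.nat 10 = 32 + 2 ^ d)
    (hg : ∀ i < 2 ^ d, σ₀.real (32 + i) = g (pts w d i)) :
    WP f ω transformProg (fun σ => σ.vec = σ₀.vec ∧ σ.used = σ₀.used ∧ σ.asked = σ₀.asked ∧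
      (∀ i < 10, σ.nat i = σ₀.nat i) ∧
      (∀ i < 32, i ≠ 21 → σ.real i = σ₀.real i) ∧
      (∃ a, 32 ≤ a ∧ σ.nat 11 = a ∧ σ.nat 10 = a + 2 ^ d ∧
        ∀ c < 2 ^ d, σ.real (a + c) = fam d (fun i : Fin d => w (d - i)) g c (w 0)) ∧
      σ.time ≤ σ₀.time + 4 + 9 * 2 ^ d * d) σ₀ := by
  refine WP.seq (WP.cons (WP.cons (WP.cons (WP.nil ?_))))
  -- After `k` rounds the array is a table with rows indexed by the points of the cube in the
  -- remaining `d - k` directions and columns by the `2 ^ k` parts.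
  refine WP.loop (fun k σ => σ.vec = σ₀.vec ∧ σ.used = σ₀.used ∧ σ.asked = σ₀.asked ∧
      (∀ i < 10, σ.nat i = σ₀.nat i) ∧
      (∀ i < 32, i ≠ 21 → σ.real i = σ₀.real i) ∧
      σ.nat 13 = 2 ^ k ∧
      (∃ a, 32 ≤ a ∧ σ.nat 11 = a ∧ σ.nat 10 = a + 2 ^ d ∧ σ.nat 12 = a + h ∧
        ∀ i < 2 ^ (d - k), ∀ c < 2 ^ k,
          σ.real (a + (i * 2 ^ k + c))
            = fam k (fun i : Fin k => w (d - i)) g c (pts w (d - k) i)) ∧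
      σ.time ≤ σ₀.time + 3 + 9 * 2 ^ d * k) d ?_ ?_ ?_
  · refine ⟨rfl, rfl, rfl, ?_, ?_, ?_, ⟨32, le_rfl, ?_, ?_, ?_, ?_⟩, ?_⟩
    · intro i hi
      have m2 : i ≠ 11 := by omega
      have m3 : i ≠ 12 := by omega
      have m4 : i ≠ 13 := by omega
      simp [m2, m3, m4]
    · intro i _ _; simp
    · simp [h3]
    · simp
    · simp [h10]
    · simp [h4]
    · intro i hi c hc
      have : c = 0 := by simpa using hc
      subst this
      simpa [fam] using hg i hi
    · simp
  · rintro k hk τ ⟨i1, i2, i3, i4, ir, i13, ⟨a, ha, i11, i10, i12, iA⟩, it⟩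
    have e3 : τ.nat 3 = 1 := by rw [i4 3 (by decide), h3]
    have e4 : τ.nat 4 = h := by rw [i4 4 (by decide), h4]
    have eB : τ.nat 2 = 2 ^ d := by rw [i4 2 (by decide), hB]
    have e2 : τ.real 2 = 1 / 2 := by rw [ir 2 (by omega) (by decide), h2]
    have hlt : 2 ^ k < 2 ^ d := Nat.pow_lt_pow_right (by norm_num) hk
    refine ⟨by simp [i13, eB, hlt], ?_⟩
    refine (wp_roundProg τ.tick a h (a + 2 ^ d) (2 ^ k) e2 e3 e4 i10 i11 i12 i13 ha
      (by omega)).mono ?_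
    rintro σ ⟨j1, j2, j3, j4, j10, j11, j12, j13, jr, ja, jt⟩
    refine ⟨j1.trans i1, j2.trans i2, j3.trans i3, fun i hi => (j4 i hi).trans (i4 i hi),
      fun i hi h21 => (jr i (by omega) h21).trans (ir i hi h21), by rw [j13, pow_succ, mul_comm],
      ⟨a + 2 ^ d, by omega, by omega, by omega, by omega, ?_⟩, ?_⟩
    · intro i hi c hc
      obtain ⟨m, rfl⟩ : ∃ m, d = k + m + 1 := ⟨d - k - 1, by omega⟩
      have s1 : k + m + 1 - (k + 1) = m := by omega
      have s2 : k + m + 1 - k = m + 1 := by omega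
      rw [s1] at hi ⊢
      rw [s2] at iA
      rw [pow_succ] at hc
      have hh : h = 2 ^ m * 2 ^ k := by
        have : 2 ^ (k + m + 1) = 2 * (2 ^ m * 2 ^ k) := by ring
        omega
      have hc2 : c / 2 < 2 ^ k := by omega
      have hl : i * 2 ^ k + c / 2 < h := by
        have : (i + 1) * 2 ^ k ≤ 2 ^ m * 2 ^ k := Nat.mul_le_mul_right _ hi
        rw [add_mul, one_mul] at this
        omega
      obtain ⟨r1, r2⟩ := ja _ hl
      have p1 : τ.tick.real (a + (i * 2 ^ k + c / 2))
          = fam k (fun i : Fin k => w (k + m + 1 - i)) g (c / 2) (pts w m i) := by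
        have := iA i (by rw [pow_succ]; omega) (c / 2) hc2
        simpa [pts, hi] using this
      have p2 : τ.tick.real (a + h + (i * 2 ^ k + c / 2))
          = fam k (fun i : Fin k => w (k + m + 1 - i)) g (c / 2) (pts w m i + w (m + 1)) := by
        have := iA (i + 2 ^ m) (by rw [pow_succ]; omega) (c / 2) hc2
        have e : a + h + (i * 2 ^ k + c / 2) = a + ((i + 2 ^ m) * 2 ^ k + c / 2) := by
          rw [hh]; ring
        rw [e]
        simpa [pts] using this
      rw [p1, p2] at r1 r2
      -- The vector newly split by is `w (d - k) = w (m + 1)`, the same one that distinguishes rows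
      -- `i` and `i + 2 ^ m`.
      have efam : fam (k + 1) (fun i : Fin (k + 1) => w (k + m + 1 - i)) g c
          = half (fam k (fun i : Fin k => w (k + m + 1 - i)) g (c / 2)) (w (m + 1)) (c % 2) := by
        rw [fam]
        congr 1
        simp [s2]
      rw [efam, half]
      have hi2 : i * 2 ^ (k + 1) = 2 * (i * 2 ^ k) := by ring
      have hm : c % 2 = 0 ∨ c % 2 = 1 := by omega
      rcases hm with hm | hm
      · have e : a + 2 ^ (k + m + 1) + (i * 2 ^ (k + 1) + c)
            = a + 2 ^ (k + m + 1) + 2 * (i * 2 ^ k + c / 2) := by omega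
        rw [e, r1, hm]; ring
      · have e : a + 2 ^ (k + m + 1) + (i * 2 ^ (k + 1) + c)
            = a + 2 ^ (k + m + 1) + 2 * (i * 2 ^ k + c / 2) + 1 := by omega
        rw [e, r2, hm]; ring
    · simp only [State.tick] at jt
      have : 1 ≤ 2 ^ d := Nat.one_le_two_pow
      rw [mul_add]; omega
  · rintro τ ⟨i1, i2, i3, i4, ir, i13, ⟨a, ha, i11, i10, i12, iA⟩, it⟩
    have eB : τ.nat 2 = 2 ^ d := by rw [i4 2 (by decide), hB]
    refine ⟨by simp [i13, eB], i1, i2, i3, i4, ir, ⟨a, ha, i11, i10, fun c hc => ?_⟩, ?_⟩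
    · have := iA 0 (by simp) c hc
      simpa [pts] using this
    · simp; omega

theorem countGt_succ (W : ℕ → ℝ) (j : ℕ) (τ : ℝ) :
    countGt W (j + 1) τ = countGt W j τ + if τ < W j then 1 else 0 := by
  simp only [countGt, Finset.range_add_one, Finset.filter_insert]
  split_ifs with h
  · rw [Finset.card_insert_of_notMem (by simp)]
  · rfl

theorem wp_countProg (σ₀ : State n) (a B : ℕ) (W : ℕ → ℝ) (h3 : σ₀.nat 3 = 1)
    (h11 : σ₀.nat 11 = a) (h10 : σ₀.nat 10 = a + B) (ha : 32 ≤ a)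
    (hW : ∀ c < B, W c = σ₀.real (a + c) ^ 2) :
    WP f ω countProg (fun σ => σ.vec = σ₀.vec ∧ σ.used = σ₀.used ∧ σ.asked = σ₀.asked ∧
      (∀ i, i ≠ 6 → i ≠ 16 → σ.nat i = σ₀.nat i) ∧ σ.nat 16 = countGt W B (σ₀.real 26) ∧
      (∀ i, i ≠ 27 → σ.real i = σ₀.real i) ∧ σ.time ≤ σ₀.time + 3 + 5 * B) σ₀ := by
  refine WP.seq (WP.cons (WP.cons (WP.nil ?_)))
  refine WP.loop (fun j σ => σ.vec = σ₀.vec ∧ σ.used = σ₀.used ∧ σ.asked = σ₀.asked ∧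
      (∀ i, i ≠ 6 → i ≠ 16 → σ.nat i = σ₀.nat i) ∧ σ.nat 6 = a + j ∧
      σ.nat 16 = countGt W j (σ₀.real 26) ∧
      (∀ i, i ≠ 27 → σ.real i = σ₀.real i) ∧ σ.time ≤ σ₀.time + 2 + 5 * j) B ?_ ?_ ?_
  · refine ⟨rfl, rfl, rfl, ?_, ?_, ?_, ?_, ?_⟩
    · intro i h6 h16; simp [h6, h16]
    · simp [h11]
    · simp [countGt]
    · intro i _; simp
    · simp
  · rintro j hj τ ⟨i1, i2, i3, i4, i6, i16, ir, it⟩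
    have e3 : τ.nat 3 = 1 := by rw [i4 3 (by decide) (by decide), h3]
    have e10 : τ.nat 10 = a + B := by rw [i4 10 (by decide) (by decide), h10]
    have e26 : τ.real 26 = σ₀.real 26 := ir 26 (by decide)
    have ej : τ.real (a + j) = σ₀.real (a + j) := ir _ (by omega)
    refine ⟨by simp [i6, e10, hj], WP.seq (WP.op (WP.seq (WP.ite ?_ ?_)))⟩
    · intro hc
      simp [i6, e26, ej, ← sq, ← hW j hj] at hc
      refine WP.op (WP.op ?_)
      refine ⟨by simp [i1], by simp [i2], by simp [i3], ?_, ?_, ?_, ?_, ?_⟩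
      · intro i h6 h16; simp [h6, h16, i4 i h6 h16]
      · simp [i6, e3]; omega
      · simp [i16, e3, countGt_succ, hc]
      · intro i hi; simp [hi, ir i hi]
      · simp; omega
    · intro hc
      simp only [effect, State.tick, State.setR, State.getR, Addr.loc, holds,
        Function.update_apply, i6, e26, ej, ← sq, ← hW j hj] at hc
      simp at hc
      refine WP.skip (WP.op ?_)
      refine ⟨by simp [i1], by simp [i2], by simp [i3], ?_, ?_, ?_, ?_, ?_⟩
      · intro i h6 h16; simp [h6, i4 i h6 h16]
      · simp [i6, e3]; omega
      · simp [i16, countGt_succ, hc]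
      · intro i hi; simp [hi, ir i hi]
      · simp; omega
  · rintro τ ⟨i1, i2, i3, i4, i6, i16, ir, it⟩
    have e10 : τ.nat 10 = a + B := by rw [i4 10 (by decide) (by decide), h10]
    refine ⟨by simp [i6, e10], i1, i2, i3, i4, i16, ir, ?_⟩
    simp; omega

/-- The gap is halved each round, and the lower end moves up exactly when more than `s` squares
exceed the midpoint. This preserves both hypotheses of `topBound_le`; `R` is the first round at
which the gap is no longer above the tolerance in real cell `24`. -/
theorem wp_bisectProg (σ₀ : State n) (a B R s : ℕ) (W : ℕ → ℝ) (h1 : σ₀.nat 1 = s)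
    (h3 : σ₀.nat 3 = 1) (h11 : σ₀.nat 11 = a) (h10 : σ₀.nat 10 = a + B) (ha : 32 ≤ a)
    (h2 : σ₀.real 2 = 1 / 2) (h4 : σ₀.real 4 = B)
    (hW : ∀ c < B, W c = σ₀.real (a + c) ^ 2) (hWB : ∀ c < B, W c ≤ B)
    (hR : B / 2 ^ R ≤ σ₀.real 24) (hR' : ∀ k < R, σ₀.real 24 < B / 2 ^ k) :
    WP f ω bisectProg (fun σ => σ.vec = σ₀.vec ∧ σ.used = σ₀.used ∧ σ.asked = σ₀.asked ∧
      (∀ i, i ≠ 6 → i ≠ 16 → σ.nat i = σ₀.nat i) ∧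
      (∀ i, i ≠ 22 → i ≠ 23 → i ≠ 26 → i ≠ 27 → σ.real i = σ₀.real i) ∧
      (∃ lo g, σ.real 22 = lo ∧ σ.real 23 = g ∧ 0 ≤ lo ∧ 0 ≤ g ∧ g ≤ σ₀.real 24 ∧
        countGt W B (lo + g) ≤ s ∧ (lo = 0 ∨ s < countGt W B lo)) ∧
      σ.time ≤ σ₀.time + 3 + R * (5 * B + 8)) σ₀ := by
  refine WP.seq (WP.cons (WP.cons (WP.nil ?_)))
  refine WP.loop (fun k σ => σ.vec = σ₀.vec ∧ σ.used = σ₀.used ∧ σ.asked = σ₀.asked ∧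
      (∀ i, i ≠ 6 → i ≠ 16 → σ.nat i = σ₀.nat i) ∧
      (∀ i, i ≠ 22 → i ≠ 23 → i ≠ 26 → i ≠ 27 → σ.real i = σ₀.real i) ∧
      σ.real 23 = B / 2 ^ k ∧ 0 ≤ σ.real 22 ∧
      countGt W B (σ.real 22 + B / 2 ^ k) ≤ s ∧
        (σ.real 22 = 0 ∨ s < countGt W B (σ.real 22)) ∧
      σ.time ≤ σ₀.time + 2 + k * (5 * B + 8)) R ?_ ?_ ?_
  · refine ⟨rfl, rfl, rfl, ?_, ?_, ?_, ?_, ?_, ?_, ?_⟩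
    · intro i _ _; simp
    · intro i h22 h23 _ _; simp [h22, h23]
    · simp [h4]
    · simp
    · have : countGt W B (B : ℝ) = 0 := by
        rw [countGt, Finset.card_eq_zero, Finset.filter_eq_empty_iff]
        intro c hc
        exact not_lt.2 (hWB c (Finset.mem_range.1 hc))
      simp [this]
    · simp
    · simp
  · rintro k hk τ ⟨i1, i2, i3, i4, ir, i23, i22, ic, il, it⟩
    have e3 : τ.nat 3 = 1 := by rw [i4 3 (by decide) (by decide), h3]
    have e1 : τ.nat 1 = s := by rw [i4 1 (by decide) (by decide), h1]
    have e10 : τ.nat 10 = a + B := by rw [i4 10 (by decide) (by decide), h10]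
    have e11 : τ.nat 11 = a := by rw [i4 11 (by decide) (by decide), h11]
    have e24 : τ.real 24 = σ₀.real 24 := ir 24 (by decide) (by decide) (by decide) (by decide)
    have e2 : τ.real 2 = 1 / 2 := by
      rw [ir 2 (by decide) (by decide) (by decide) (by decide), h2]
    have eg : (B : ℝ) / 2 ^ k * (1 / 2) = B / 2 ^ (k + 1) := by
      rw [pow_succ, ← div_div]; ring
    refine ⟨by simpa [i23, e24] using hR' k hk, WP.seq (WP.cons (WP.cons (WP.nil (WP.seq ?_))))⟩
    refine (wp_countProg _ a B W (by simpa using e3) (by simpa using e11) (by simpa using e10) ha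
      ?_).mono ?_
    · intro c hc
      have n23 : a + c ≠ 23 := by omega
      have n26 : a + c ≠ 26 := by omega
      rw [hW c hc, ← ir (a + c) (by omega) (by omega) (by omega) (by omega)]
      simp [n23, n26]
    rintro σ ⟨j1, j2, j3, j4, j16, jr, jt⟩
    have f22 : σ.real 22 = τ.real 22 := by rw [jr 22 (by decide)]; simp
    have f23 : σ.real 23 = B / 2 ^ (k + 1) := by
      rw [jr 23 (by decide)]; simp only [effect, State.tick, State.setR, State.getR, Addr.loc,
        Function.update_apply, e2, i23, eg]; simp
    have f26 : σ.real 26 = τ.real 22 + B / 2 ^ (k + 1) := by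
      rw [jr 26 (by decide)]; simp only [effect, State.tick, State.setR, State.getR, Addr.loc,
        Function.update_apply, e2, i23, eg]; simp
    have g26 : σ.nat 16 = countGt W B (σ.real 26) := by
      rw [j16, jr 26 (by decide)]
    have f1 : σ.nat 1 = s := by rw [j4 1 (by decide) (by decide)]; simpa using e1
    have fn : ∀ i, i ≠ 6 → i ≠ 16 → σ.nat i = σ₀.nat i := by
      intro i h6 h16; rw [j4 i h6 h16]; simpa using i4 i h6 h16
    have fr : ∀ i, i ≠ 22 → i ≠ 23 → i ≠ 26 → i ≠ 27 → σ.real i = σ₀.real i := by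
      intro i h22 h23 h26 h27
      rw [jr i h27, ← ir i h22 h23 h26 h27]; simp [h23, h26]
    have ft : σ.time ≤ τ.time + 6 + 5 * B := by
      refine jt.trans ?_; simp
    have esplit : (B : ℝ) / 2 ^ k = B / 2 ^ (k + 1) + B / 2 ^ (k + 1) := by rw [← eg]; ring
    have hpos : (0 : ℝ) ≤ B / 2 ^ (k + 1) := by positivity
    refine WP.ite ?_ ?_
    · intro hc
      simp [f1, g26, f26] at hc
      refine WP.op ⟨?_, ?_, ?_, ?_, ?_, ?_, ?_, ?_, ?_, ?_⟩
      · simp [j1, i1]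
      · simp [j2, i2]
      · simp [j3, i3]
      · intro i h6 h16; simpa using fn i h6 h16
      · intro i h22 h23 h26 h27; simpa [h22] using fr i h22 h23 h26 h27
      · simp [f23]
      · simp [f26]; linarith
      · rw [esplit, ← add_assoc] at ic
        simpa [f26] using ic
      · right; simpa [f26] using hc
      · simp; rw [add_mul, one_mul]; omega
    · intro hc
      simp [f1, g26, f26] at hc
      refine WP.skip ⟨?_, ?_, ?_, ?_, ?_, ?_, ?_, ?_, ?_, ?_⟩
      · simp [j1, i1]
      · simp [j2, i2]
      · simp [j3, i3]
      · intro i h6 h16; simpa using fn i h6 h16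
      · intro i h22 h23 h26 h27; simpa using fr i h22 h23 h26 h27
      · simp [f23]
      · simpa [f22] using i22
      · simpa [f22] using hc
      · simpa [f22] using il
      · simp; rw [add_mul, one_mul]; omega
  · rintro τ ⟨i1, i2, i3, i4, ir, i23, i22, ic, il, it⟩
    have e24 : τ.real 24 = σ₀.real 24 := ir 24 (by decide) (by decide) (by decide) (by decide)
    refine ⟨by simpa [i23, e24] using hR, i1, i2, i3, i4, ir,
      ⟨_, _, rfl, i23, i22, by positivity, hR, ic, il⟩, ?_⟩
    simp; omega

theorem wp_sumProg (σ₀ : State n) (a B s : ℕ) (W : ℕ → ℝ) (lo g : ℝ)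
    (h3 : σ₀.nat 3 = 1) (h11 : σ₀.nat 11 = a) (h10 : σ₀.nat 10 = a + B) (ha : 32 ≤ a)
    (h12 : σ₀.real 12 = s) (hone : σ₀.real 11 = 1) (h22 : σ₀.real 22 = lo) (h23 : σ₀.real 23 = g)
    (hW : ∀ c < B, W c = σ₀.real (a + c) ^ 2) :
    WP f ω sumProg (fun σ => σ.vec = σ₀.vec ∧ σ.used = σ₀.used ∧ σ.asked = σ₀.asked ∧
      (∀ i, i ≠ 6 → σ.nat i = σ₀.nat i) ∧
      (∀ i, i ≠ 26 → i ≠ 27 → i ≠ 28 → σ.real i = σ₀.real i) ∧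
      σ.real 28 = min (topBound W B s (lo + g)) 1 ∧
      σ.time ≤ σ₀.time + 6 + 6 * B) σ₀ := by
  refine WP.seq (WP.cons (WP.cons (WP.cons (WP.nil (WP.seq ?_)))))
  refine WP.loop (fun j σ => σ.vec = σ₀.vec ∧ σ.used = σ₀.used ∧ σ.asked = σ₀.asked ∧
      (∀ i, i ≠ 6 → σ.nat i = σ₀.nat i) ∧ σ.nat 6 = a + j ∧
      (∀ i, i ≠ 26 → i ≠ 27 → i ≠ 28 → σ.real i = σ₀.real i) ∧
      σ.real 26 = lo + g ∧ σ.real 28 = topBound W j s (lo + g) ∧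
      σ.time ≤ σ₀.time + 3 + 6 * j) B ?_ ?_ ?_
  · refine ⟨rfl, rfl, rfl, ?_, ?_, ?_, ?_, ?_, ?_⟩
    · intro i h6; simp [h6]
    · simp [h11]
    · intro i h26 _ h28; simp [h26, h28]
    · simp [h22, h23]
    · simp [h22, h23, h12, topBound]
    · simp
  · rintro j hj τ ⟨i1, i2, i3, i4, i6, ir, i26, i28, it⟩
    have e3 : τ.nat 3 = 1 := by rw [i4 3 (by decide), h3]
    have e10 : τ.nat 10 = a + B := by rw [i4 10 (by decide), h10]
    have ej : τ.real (a + j) = σ₀.real (a + j) := ir _ (by omega) (by omega) (by omega)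
    have eW : τ.real (a + j) * τ.real (a + j) = W j := by rw [hW j hj, ej, sq]
    have etop : topBound W (j + 1) s (lo + g)
        = topBound W j s (lo + g) + if lo + g < W j then W j - (lo + g) else 0 := by
      rw [topBound, Finset.sum_range_succ, topBound, add_assoc]
    refine ⟨by simp [i6, e10, hj], WP.seq (WP.op (WP.seq (WP.ite ?_ ?_)))⟩
    · intro hc
      simp [i6, i26, eW] at hc
      refine WP.cons (WP.cons (WP.nil (WP.op ?_)))
      refine ⟨by simp [i1], by simp [i2], by simp [i3], ?_, ?_, ?_, ?_, ?_, ?_⟩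
      · intro i h6; simp [h6, i4 i h6]
      · simp [i6, e3]; omega
      · intro i h26 h27 h28; simp [h27, h28, ir i h26 h27 h28]
      · simp [i26]
      · simp [i6, i26, i28, eW, etop, hc]; ring
      · simp; omega
    · intro hc
      simp only [effect, State.tick, State.setR, State.getR, Addr.loc, holds,
        Function.update_apply, i6, i26, eW] at hc
      simp at hc
      refine WP.skip (WP.op ?_)
      refine ⟨by simp [i1], by simp [i2], by simp [i3], ?_, ?_, ?_, ?_, ?_, ?_⟩
      · intro i h6; simp [h6, i4 i h6]
      · simp [i6, e3]; omega
      · intro i h26 h27 h28; simp [h27, ir i h26 h27 h28]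
      · simp [i26]
      · simp [i28, etop, not_lt.2 hc]
      · simp; omega
  · rintro τ ⟨i1, i2, i3, i4, i6, ir, i26, i28, it⟩
    have e10 : τ.nat 10 = a + B := by rw [i4 10 (by decide), h10]
    have e11 : τ.real 11 = 1 := by rw [ir 11 (by decide) (by decide) (by decide), hone]
    refine ⟨by simp [i6, e10], WP.ite ?_ ?_⟩
    · intro hc
      simp [e11, i28] at hc
      refine WP.op ⟨i1, i2, i3, i4, ?_, ?_, ?_⟩
      · intro i h26 h27 h28; simp [h28, ir i h26 h27 h28]
      · simp [e11, hc.le]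
      · simp; omega
    · intro hc
      simp [e11, i28] at hc
      refine WP.skip ⟨i1, i2, i3, i4, ir, ?_, ?_⟩
      · simp [i28, hc]
      · simp; omega

/-- Splitting replaces a value by half the sum or difference of two values, so a bound on the
absolute values persists. -/
theorem fam_sq_le (g : Vec n → ℝ) {B : ℝ} (hg : ∀ x, g x ^ 2 ≤ B) (k : ℕ) (u : Fin k → Vec n)
    (c : ℕ) (x : Vec n) : fam k u g c x ^ 2 ≤ B := by
  induction k generalizing c x with
  | zero => exact hg x
  | succ k ih =>
    rw [fam, half]
    have h1 := ih (Fin.init u) (c / 2) x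
    have h2 := ih (Fin.init u) (c / 2) (x + u (Fin.last k))
    rcases neg_one_pow_eq_or ℝ (c % 2) with h | h <;> rw [h]
    · nlinarith [sq_nonneg (fam k (Fin.init u) g (c / 2) x
        - fam k (Fin.init u) g (c / 2) (x + u (Fin.last k)))]
    · nlinarith [sq_nonneg (fam k (Fin.init u) g (c / 2) x
        + fam k (Fin.init u) g (c / 2) (x + u (Fin.last k)))]

theorem trunc_sq_le (f : Vec n → ℝ) {B : ℝ} (hB : 0 ≤ B) (x : Vec n) : trunc f B x ^ 2 ≤ B := by
  rw [trunc]
  split_ifs with h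
  · rw [sq]; exact h.le
  · simpa using hB

/-- The memory holds the parameters of the runs. -/
structure HasParams (σ : State n) (d h s : ℕ) (thr : ℝ) : Prop where
  n1 : σ.nat 1 = s
  n2 : σ.nat 2 = 2 ^ d
  n3 : σ.nat 3 = 1
  n4 : σ.nat 4 = h
  n9 : σ.nat 9 = 2 ^ d + 1
  r2 : σ.real 2 = 1 / 2
  r4 : σ.real 4 = 2 ^ d
  r11 : σ.real 11 = 1
  r12 : σ.real 12 = s
  r24 : σ.real 24 = thr

/-- The possible results of a run with the random vectors `w`. -/
def IsEstimate (f : Vec n → ℝ) (d s : ℕ) (thr : ℝ) (w : ℕ → Vec n) (F : ℝ) : Prop :=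
  ∃ (W : ℕ → ℝ) (lo g : ℝ), F = topBound W (2 ^ d) s (lo + g) ∧
    (∀ c < 2 ^ d, W c = fam d (fun i : Fin d => w (d - i)) (trunc f (2 ^ d)) c (w 0) ^ 2) ∧
    0 ≤ lo ∧ 0 ≤ g ∧ g ≤ thr ∧ countGt W (2 ^ d) (lo + g) ≤ s ∧
    (lo = 0 ∨ s < countGt W (2 ^ d) lo)

/-- The facts `A` to `E'` track which registers survive each subroutine. The result is specified
only up to the relation `IsEstimate`, since the error analysis uses nothing about the threshold
beyond its bracketing properties. -/
theorem wp_runProg (σ₀ : State n) (d h s R : ℕ) (thr : ℝ) (hd : 2 ^ d = 2 * h)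
    (hσ : HasParams σ₀ d h s thr)
    (hR : 2 ^ d / 2 ^ R ≤ thr) (hR' : ∀ k < R, thr < 2 ^ d / 2 ^ k) :
    WP f ω runProg (fun σ => HasParams σ d h s thr ∧ σ.real 5 = σ₀.real 5 ∧
      σ.real 7 = σ₀.real 7 + 1 ∧
      (∃ F, IsEstimate f d s thr (fun i => ω (σ₀.used + i)) F ∧
        σ.real 8 = σ₀.real 8 + min F 1) ∧
      σ.used = σ₀.used + (d + 1) ∧
      σ.asked = pointList (pts (fun i => ω (σ₀.used + i)) d) (2 ^ d) ++ σ₀.asked ∧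
      σ.time ≤ σ₀.time + 2 ^ d * (43 + 9 * d + 13 * R)) σ₀ := by
  set w : ℕ → Vec n := fun i => ω (σ₀.used + i) with hw
  have hone : 1 ≤ 2 ^ d := Nat.one_le_two_pow
  refine WP.seq ((wp_genProg σ₀ d hσ.n3 hσ.n9).mono ?_)
  rintro σ₁ ⟨a1, a2, a3, a4, a5, a6⟩
  have A : ∀ i, i ≠ 6 ∧ i ≠ 7 ∧ i ≠ 8 → σ₁.nat i = σ₀.nat i := fun i h => a3 i h.1 h.2.1 h.2.2
  refine WP.seq ((wp_queryProg σ₁ (2 ^ d) ((A 3 (by decide)).trans hσ.n3)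
    ((A 9 (by decide)).trans hσ.n9)).mono ?_)
  rintro σ₂ ⟨b1, b2, b3, b4, b5, b6, b7, b8⟩
  have B : ∀ i, (i ≠ 6 ∧ i ≠ 7 ∧ i ≠ 8) ∧ i ≠ 10 → σ₂.nat i = σ₀.nat i := fun i h =>
    (b3 i h.1.1 h.2).trans (A i h.1)
  have B' : ∀ i, i < 32 ∧ i ≠ 9 ∧ i ≠ 20 → σ₂.real i = σ₀.real i := fun i h =>
    (b5 i h.1 h.2.1 h.2.2).trans (by rw [a1])
  have hdata : ∀ i < 2 ^ d, σ₂.real (32 + i) = trunc f (2 ^ d) (pts w d i) := by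
    intro i hi
    rw [b6 i hi, a4 i hi, a1, hσ.r4]
  refine WP.seq ((wp_transformProg σ₂ d h (trunc f (2 ^ d)) w hd
    ((B' 2 (by decide)).trans hσ.r2) ((B 3 (by decide)).trans hσ.n3)
    ((B 4 (by decide)).trans hσ.n4) ((B 2 (by decide)).trans hσ.n2) b4 hdata).mono ?_)
  rintro σ₃ ⟨c1, c2, c3, c4, c5, ⟨a, ha, c11, c10, cA⟩, c6⟩
  have C : ∀ i, i < 10 ∧ i ≠ 6 ∧ i ≠ 7 ∧ i ≠ 8 → σ₃.nat i = σ₀.nat i := fun i h =>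
    (c4 i h.1).trans (B i ⟨h.2, by omega⟩)
  have C' : ∀ i, i < 32 ∧ i ≠ 9 ∧ i ≠ 20 ∧ i ≠ 21 → σ₃.real i = σ₀.real i := fun i h =>
    (c5 i h.1 h.2.2.2).trans (B' i ⟨h.1, h.2.1, h.2.2.1⟩)
  set W : ℕ → ℝ := fun c => σ₃.real (a + c) ^ 2 with hWdef
  have hWfam : ∀ c < 2 ^ d,
      W c = fam d (fun i : Fin d => w (d - i)) (trunc f (2 ^ d)) c (w 0) ^ 2 := by
    intro c hc
    simp only [hWdef, cA c hc]
  have hthr : σ₃.real 24 = thr := (C' 24 (by decide)).trans hσ.r24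
  refine WP.seq ((wp_bisectProg σ₃ a (2 ^ d) R s W ((C 1 (by decide)).trans hσ.n1)
    ((C 3 (by decide)).trans hσ.n3) c11 c10 ha ((C' 2 (by decide)).trans hσ.r2)
    (by rw [C' 4 (by decide), hσ.r4]; push_cast; rfl) (fun c _ => rfl) ?_
    (by rw [hthr]; push_cast; exact hR) (by rw [hthr]; push_cast; exact hR')).mono ?_)
  · intro c hc
    rw [hWfam c hc]
    push_cast
    exact fam_sq_le _ (trunc_sq_le f (by positivity)) _ _ _ _
  rintro σ₄ ⟨d1, d2, d3, d4, d5, ⟨lo, g, d22, d23, hlo0, hg0, hg, hcount, hlo⟩, d6⟩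
  have D : ∀ i, i < 10 ∧ i ≠ 6 ∧ i ≠ 7 ∧ i ≠ 8 → σ₄.nat i = σ₀.nat i := fun i h =>
    (d4 i h.2.1 (by omega)).trans (C i h)
  have D' : ∀ i, (i < 32 ∧ i ≠ 9 ∧ i ≠ 20 ∧ i ≠ 21) ∧ i ≠ 22 ∧ i ≠ 23 ∧ i ≠ 26 ∧ i ≠ 27 →
      σ₄.real i = σ₀.real i := fun i h =>
    (d5 i h.2.1 h.2.2.1 h.2.2.2.1 h.2.2.2.2).trans (C' i h.1)
  refine WP.seq ((wp_sumProg σ₄ a (2 ^ d) s W lo g ((D 3 (by decide)).trans hσ.n3)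
    ((d4 11 (by decide) (by decide)).trans c11) ((d4 10 (by decide) (by decide)).trans c10) ha
    ((D' 12 (by decide)).trans hσ.r12) ((D' 11 (by decide)).trans hσ.r11) d22 d23 ?_).mono ?_)
  · intro c hc
    rw [d5 _ (by omega) (by omega) (by omega) (by omega)]
  rintro σ₅ ⟨e1, e2, e3, e4, e5, e28, e6⟩
  have E : ∀ i, i < 10 ∧ i ≠ 6 ∧ i ≠ 7 ∧ i ≠ 8 → σ₅.nat i = σ₀.nat i := fun i h =>
    (e4 i h.2.1).trans (D i h)
  have E' : ∀ i, ((i < 32 ∧ i ≠ 9 ∧ i ≠ 20 ∧ i ≠ 21) ∧ i ≠ 22 ∧ i ≠ 23 ∧ i ≠ 26 ∧ i ≠ 27) ∧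
      i ≠ 28 → σ₅.real i = σ₀.real i := fun i h =>
    (e5 i h.1.2.2.2.1 h.1.2.2.2.2 h.2).trans (D' i h.1)
  refine WP.cons (WP.cons (WP.nil ⟨⟨?_, ?_, ?_, ?_, ?_, ?_, ?_, ?_, ?_, ?_⟩, ?_, ?_,
    ⟨_, ⟨W, lo, g, rfl, hWfam, hlo0, hg0, hg.trans hthr.le, hcount, hlo⟩, ?_⟩, ?_, ?_, ?_⟩))
  · simp [E 1 (by decide), hσ.n1]
  · simp [E 2 (by decide), hσ.n2]
  · simp [E 3 (by decide), hσ.n3]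
  · simp [E 4 (by decide), hσ.n4]
  · simp [E 9 (by decide), hσ.n9]
  · simp [E' 2 (by decide), hσ.r2]
  · simp [E' 4 (by decide), hσ.r4]
  · simp [E' 11 (by decide), hσ.r11]
  · simp [E' 12 (by decide), hσ.r12]
  · simp [E' 24 (by decide), hσ.r24]
  · simp [E' 5 (by decide)]
  · simp [E' 7 (by decide), E' 11 (by decide), hσ.r11]
  · simp [E' 8 (by decide), e28]
  · simp [e2, d2, c2, b2, a5]
  · simp only [effect, State.tick, State.setR, e3, d3, c3, b7, a2]
    rw [pointList_congr fun i hi => a4 i hi]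
  · simp
    -- Apart from the transform rounds and the bisection, the cost is at most `18 + 25 * 2 ^ d ≤ 43
    -- * 2 ^ d`.
    have h1 : R * (5 * 2 ^ d + 8) ≤ 2 ^ d * (13 * R) := by nlinarith
    have h2 : 2 ^ d * (43 + 9 * d + 13 * R)
      = 43 * 2 ^ d + 9 * 2 ^ d * d + 2 ^ d * (13 * R) := by ring
    omega

/-- The queries of the first `t` runs, the latest first. -/
def allQueries (d : ℕ) (ω : ℕ → Vec n) : ℕ → List (Vec n)
  | 0 => []
  | t + 1 => pointList (pts (fun i => ω (t * (d + 1) + i)) d) (2 ^ d) ++ allQueries d ω t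

theorem length_allQueries (d : ℕ) (ω : ℕ → Vec n) (t : ℕ) :
    (allQueries d ω t).length = t * 2 ^ d := by
  induction t with
  | zero => simp [allQueries]
  | succ t ih => simp [allQueries, length_pointList, ih]; ring

/-- Without rounding or integer multiplication, `2 ^ d` is found by doubling and `L` by halving.
Natural-number cell `4` keeps the value before the last doubling, so it ends up as `2 ^ (d - 1)`
once `1 ≤ d`. Real cell `5` receives the bound on the run counter, `L` copies of `2 / (ε * ε)`. -/
theorem wp_setupProg (σ₀ : State n) (s d L : ℕ) (ε δ : ℝ)
    (hσ : σ₀ = (((rconst (dir 2) (1 / 2)).effect f ω (State.init n s ε δ)).tick).tick)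
    (hd : s / (ε * ε) * 1024 ≤ 2 ^ d) (hd' : ∀ k < d, 2 ^ k < s / (ε * ε) * 1024) (hd1 : 1 ≤ d)
    (hL : (1 / 2) ^ L ≤ δ) (hL' : ∀ k < L, δ < (1 / 2) ^ k) :
    WP f ω setupProg (fun σ => HasParams σ d (2 ^ (d - 1)) s (ε / (s * 16)) ∧
      σ.real 5 = L * (2 / (ε * ε)) ∧ σ.real 7 = 0 ∧ σ.real 8 = 0 ∧ σ.used = 0 ∧ σ.asked = [] ∧
      σ.time ≤ 30 + 4 * d + 3 * L) σ₀ := by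
  subst hσ
  refine WP.seq (WP.cons (WP.cons (WP.cons (WP.cons (WP.cons
    (WP.cons (WP.cons (WP.cons (WP.cons (WP.cons
    (WP.cons (WP.cons (WP.cons (WP.cons (WP.cons
    (WP.nil (WP.seq ?_)))))))))))))))))
  refine WP.loop (fun k σ => σ.nat 1 = s ∧ σ.nat 2 = 2 ^ k ∧ σ.nat 3 = 1 ∧
    (1 ≤ k → σ.nat 4 = 2 ^ (k - 1)) ∧ σ.real 1 = δ ∧ σ.real 2 = 1 / 2 ∧
    σ.real 3 = s / (ε * ε) * 1024 ∧ σ.real 4 = 2 ^ k ∧ σ.real 5 = 0 ∧ σ.real 6 = 1 ∧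
    σ.real 7 = 0 ∧ σ.real 8 = 0 ∧ σ.real 10 = 2 / (ε * ε) ∧ σ.real 11 = 1 ∧ σ.real 12 = s ∧
    σ.real 24 = ε / (s * 16) ∧ σ.used = 0 ∧ σ.asked = [] ∧ σ.time ≤ 17 + 4 * k) d ?_ ?_ ?_
  · simp [State.init]
  · rintro k hk τ ⟨n1, n2, n3, n4, r1, r2, r3, r4, r5, r6, r7, r8, r10, r11, r12, r24, iu, ia, it⟩
    refine ⟨by simpa [r3, r4] using hd' k hk, WP.cons (WP.cons (WP.cons (WP.nil ?_)))⟩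
    refine ⟨by simp [n1], by simp [n2, pow_succ]; omega, by simp [n3], ?_, by simp [r1],
      by simp [r2], by simp [r3], by simp [r4, pow_succ]; ring, by simp [r5], by simp [r6],
      by simp [r7], by simp [r8], by simp [r10], by simp [r11], by simp [r12], by simp [r24],
      by simp [iu], by simp [ia], ?_⟩
    · intro _; simp [n2]
    · simp; omega
  rintro τ ⟨n1, n2, n3, n4, r1, r2, r3, r4, r5, r6, r7, r8, r10, r11, r12, r24, iu, ia, it⟩
  refine ⟨by simpa [r3, r4] using hd, WP.seq ?_⟩
  refine WP.loop (fun k σ => σ.nat 1 = s ∧ σ.nat 2 = 2 ^ d ∧ σ.nat 3 = 1 ∧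
    σ.nat 4 = 2 ^ (d - 1) ∧ σ.real 1 = δ ∧ σ.real 2 = 1 / 2 ∧
    σ.real 4 = 2 ^ d ∧ σ.real 5 = k * (2 / (ε * ε)) ∧ σ.real 6 = (1 / 2) ^ k ∧
    σ.real 7 = 0 ∧ σ.real 8 = 0 ∧ σ.real 10 = 2 / (ε * ε) ∧ σ.real 11 = 1 ∧ σ.real 12 = s ∧
    σ.real 24 = ε / (s * 16) ∧ σ.used = 0 ∧ σ.asked = [] ∧ σ.time ≤ 18 + 4 * d + 3 * k) L ?_ ?_ ?_
  · refine ⟨n1, n2, n3, n4 hd1, r1, r2, r4, by simp [r5], by simp [r6], r7, r8, r10, r11, r12, r24,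
      iu, ia, ?_⟩
    simp; omega
  · rintro k hk τ ⟨n1, n2, n3, n4, r1, r2, r4, r5, r6, r7, r8, r10, r11, r12, r24, iu, ia, it⟩
    refine ⟨by simpa [r1, r6] using hL' k hk, WP.cons (WP.cons (WP.nil ?_))⟩
    refine ⟨n1, n2, n3, n4, by simp [r1],
      by simp [r2], by simp [r4], by simp [r5, r10]; ring, by simp [r6, r2, pow_succ],
      by simp [r7], by simp [r8], by simp [r10], by simp [r11], by simp [r12], by simp [r24],
      iu, ia, ?_⟩
    simp; omega
  · rintro τ ⟨n1, n2, n3, n4, r1, r2, r4, r5, r6, r7, r8, r10, r11, r12, r24, iu, ia, it⟩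
    refine ⟨by simpa [r1, r6] using hL, WP.op ⟨⟨by simp [n1], by simp [n2], by simp [n3],
      by simp [n4], by simp [n2, n3], r2, r4, r11, r12, r24⟩, r5, r7, r8, iu, ia, ?_⟩⟩
    simp; omega

/-- A deterministic statement about a single tape: probability enters only later, through the choice
of `err`. The bound `T` is the least integer at which the comparison of the run counter with real
cell `5` fails. -/
theorem wp_estimateProg (s d L T R : ℕ) (ε δ E : ℝ) (err : ℕ → ℝ) (hε : ε < 1 / 2)
    (hd : s / (ε * ε) * 1024 ≤ 2 ^ d) (hd' : ∀ k < d, 2 ^ k < s / (ε * ε) * 1024) (hd1 : 1 ≤ d)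
    (hL : (1 / 2) ^ L ≤ δ) (hL' : ∀ k < L, δ < (1 / 2) ^ k)
    (hT : L * (2 / (ε * ε)) ≤ T) (hT' : ∀ t : ℕ, t < T → t < L * (2 / (ε * ε))) (hT1 : 1 ≤ T)
    (hR : 2 ^ d / 2 ^ R ≤ ε / (s * 16)) (hR' : ∀ k < R, ε / (s * 16) < 2 ^ d / 2 ^ k)
    (herr : ∀ t F, IsEstimate f d s (ε / (s * 16)) (fun i => ω (t * (d + 1) + i)) F →
      |min F 1 - E| ≤ err t) :
    WP f ω estimateProg (fun σ => |σ.real 0 - (1 - E)| ≤ (∑ t ∈ Finset.range T, err t) / T ∧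
      σ.asked = allQueries d ω T ∧
      σ.time ≤ 33 + 4 * d + 3 * L + T * (1 + 2 ^ d * (43 + 9 * d + 13 * R)))
      (State.init n s ε δ) := by
  refine WP.seq (WP.op (WP.ite ?_ ?_))
  swap
  · intro hc
    exact absurd hε (by simpa [State.init] using hc)
  intro _
  refine WP.seq ((wp_setupProg _ s d L ε δ rfl hd hd' hd1 hL hL').mono ?_)
  rintro σ₀ ⟨hp, p5, p7, p8, pu, pa, pt⟩
  refine WP.seq (WP.loop (fun t σ => HasParams σ d (2 ^ (d - 1)) s (ε / (s * 16)) ∧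
    σ.real 5 = L * (2 / (ε * ε)) ∧ σ.real 7 = t ∧
    |σ.real 8 - t * E| ≤ ∑ i ∈ Finset.range t, err i ∧ σ.used = t * (d + 1) ∧
    σ.asked = allQueries d ω t ∧
    σ.time ≤ 30 + 4 * d + 3 * L + t * (1 + 2 ^ d * (43 + 9 * d + 13 * R))) T ?_ ?_ ?_)
  · exact ⟨hp, p5, by simp [p7], by simp [p8], by simp [pu], by simp [pa, allQueries],
      by simpa using pt⟩
  · rintro t ht τ ⟨ip, i5, i7, i8, iu, ia, it⟩
    refine ⟨by simpa [i5, i7] using hT' t ht, ?_⟩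
    have hdh : 2 ^ d = 2 * 2 ^ (d - 1) := by rw [← pow_succ', Nat.sub_add_cancel hd1]
    have ip' : HasParams τ.tick d (2 ^ (d - 1)) s (ε / (s * 16)) :=
      ⟨ip.n1, ip.n2, ip.n3, ip.n4, ip.n9, ip.r2, ip.r4, ip.r11, ip.r12, ip.r24⟩
    refine (wp_runProg τ.tick d _ s R _ hdh ip' hR hR').mono ?_
    rintro σ ⟨jp, j5, j7, ⟨F, jF, j8⟩, ju, ja, jt⟩
    have eu : τ.tick.used = t * (d + 1) := iu
    rw [eu] at jF ju ja
    refine ⟨jp, j5.trans i5, ?_, ?_, ?_, ?_, ?_⟩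
    · rw [j7]; simp [i7]
    · rw [j8, Finset.sum_range_succ]
      have e : τ.tick.real 8 + min F 1 - ((t + 1 : ℕ) : ℝ) * E
          = (τ.real 8 - t * E) + (min F 1 - E) := by simp; ring
      rw [e]
      exact (abs_add_le _ _).trans (add_le_add i8 (herr t F jF))
    · rw [ju, add_mul, one_mul]
    · rw [ja, allQueries]; simp [ia]
    · simp only [State.tick] at jt
      rw [add_mul, one_mul]; omega
  · rintro τ ⟨ip, i5, i7, i8, iu, ia, it⟩
    refine ⟨by simpa [i5, i7] using hT, WP.cons (WP.cons (WP.nil ⟨?_, ?_, ?_⟩))⟩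
    · have hT0 : (0 : ℝ) < T := by exact_mod_cast hT1
      simp [i7, ip.r11]
      have e : E - τ.real 8 / T = -(τ.real 8 - T * E) / T := by field_simp; ring
      rw [e, abs_div, abs_neg, abs_of_pos hT0]
      gcongr
    · simp [ia]
    · simp; omega

theorem wp_estimateProg_large (s : ℕ) (ε δ : ℝ) (hε : 1 / 2 ≤ ε) :
    WP f ω estimateProg (fun σ => σ.real 0 = 1 / 2 ∧ σ.asked = [] ∧ σ.time = 3)
      (State.init n s ε δ) := by
  refine WP.seq (WP.op (WP.ite ?_ ?_))
  · intro hc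
    exact absurd hε (by simpa [State.init] using hc)
  · intro _
    refine WP.op ⟨by simp, by simp [State.init], by simp [State.init]⟩

end Programs

open ProbabilityTheory

/-! ## The random tape -/

/-- The uniform law on `𝔽₂ⁿ`. -/
def unif (n : ℕ) : Measure (Vec n) := (PMF.uniformOfFintype (Vec n)).toMeasure

instance (n : ℕ) : IsProbabilityMeasure (unif n) := by unfold unif; infer_instance

instance (n : ℕ) : IsProbabilityMeasure (tapeLaw n) := by unfold tapeLaw; infer_instance

/-- Distinct positions of the tape carry independent uniform vectors; this one statement yields the
law of a block and the joint law of all blocks. -/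
theorem map_coords_tapeLaw {n : ℕ} {κ : Type*} {e : κ → ℕ} (he : Function.Injective e) :
    (tapeLaw n).map (fun ω k => ω (e k)) = Measure.infinitePi fun _ : κ => unif n := by
  have h1 : iIndepFun (fun (i : ℕ) (ω : ℕ → Vec n) => ω i) (tapeLaw n) :=
    iIndepFun_infinitePi (P := fun _ : ℕ => unif n) (X := fun _ x => x) fun _ => measurable_id
  have h2 := h1.precomp he
  rw [iIndepFun_iff_map_fun_eq_infinitePi_map (by fun_prop)] at h2
  rw [h2]
  congr 1
  funext k
  exact Measure.infinitePi_map_eval (fun _ : ℕ => unif n) (e k)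

/-- The `t`-th block of `m` consecutive vectors on the tape. -/
def block {n : ℕ} (m t : ℕ) (ω : ℕ → Vec n) (i : Fin m) : Vec n := ω (t * m + i)

theorem measurable_block {n : ℕ} (m t : ℕ) : Measurable (block (n := n) m t) := by
  unfold block; fun_prop

theorem map_block {n : ℕ} (m t : ℕ) :
    (tapeLaw n).map (block m t) = Measure.infinitePi fun _ : Fin m => unif n :=
  map_coords_tapeLaw (e := fun i : Fin m => t * m + i) fun i j h => by
    ext; simpa using h

/-- Division with remainder makes the positions `t * m + i` distinct, so the doubly indexed family
is a product; currying turns it into a product over `t` of the laws of the blocks. -/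
theorem iIndepFun_block {n : ℕ} (m : ℕ) : iIndepFun (block (n := n) m) (tapeLaw n) := by
  rw [iIndepFun_iff_map_fun_eq_infinitePi_map (measurable_block m)]
  simp only [map_block]
  have hinj : Function.Injective fun p : ℕ × Fin m => p.1 * m + (p.2 : ℕ) := by
    rintro ⟨t, i⟩ ⟨t', i'⟩ h
    have hm : 0 < m := i.pos
    have h1 : (t * m + i) / m = t := by
      rw [mul_comm, Nat.mul_add_div hm, Nat.div_eq_of_lt i.2, add_zero]
    have h2 : (t' * m + i') / m = t' := by
      rw [mul_comm, Nat.mul_add_div hm, Nat.div_eq_of_lt i'.2, add_zero]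
    simp only at h
    have h3 : t = t' := by rw [← h1, ← h2, h]
    subst h3
    have : i = i' := by ext; simpa using h
    rw [this]
  have h1 := map_coords_tapeLaw (n := n) hinj
  have h2 := Measure.infinitePi_map_curry (fun (_ : ℕ) (_ : Fin m) => unif n)
  rw [← h2, ← h1, Measure.map_map (MeasurableEquiv.measurable _) (by fun_prop)]
  rfl

theorem integral_block {n : ℕ} (m t : ℕ) (G : (Fin m → Vec n) → ℝ) :
    ∫ ω, G (block m t ω) ∂(tapeLaw n) = (∑ w, G w) / (2 ^ n) ^ m := by
  rw [← integral_map (f := G) (measurable_block m t).aemeasurable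
    (Measurable.of_discrete).aestronglyMeasurable, map_block, Measure.infinitePi_eq_pi,
    integral_fintype Integrable.of_finite, Finset.sum_div]
  refine Finset.sum_congr rfl fun w _ => ?_
  have h1 : ∀ x : Vec n, (unif n) {x} = (2 ^ n)⁻¹ := by
    intro x
    rw [unif, PMF.toMeasure_uniformOfFintype_apply _ (measurableSet_singleton x)]
    simp [ZMod.card]
  rw [Measure.real, Measure.pi_singleton]
  simp only [h1, Finset.prod_const, Finset.card_univ, Fintype.card_fin, smul_eq_mul]
  rw [ENNReal.toReal_pow, ENNReal.toReal_inv, ENNReal.toReal_pow, ENNReal.toReal_ofNat, inv_pow,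
    mul_comm, div_eq_mul_inv]

/-- Hoeffding's inequality for a function of the blocks of the tape. -/
theorem tapeLaw_mean_le {n : ℕ} (m T : ℕ) (hT : 1 ≤ T) (G : (Fin m → Vec n) → ℝ)
    (h0 : ∀ w, 0 ≤ G w) (h1 : ∀ w, G w ≤ 1) {ε δ : ℝ} (hε : 0 < ε) (hδ : 0 < δ)
    (hmean : (∑ w, G w) / (2 ^ n) ^ m ≤ ε / 2) (hTδ : 2 * Real.log (1 / δ) / ε ^ 2 ≤ T) :
    ENNReal.ofReal (1 - δ)
      ≤ tapeLaw n {ω | (∑ t ∈ Finset.range T, G (block m t ω)) / T ≤ ε} := by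
  set μ := tapeLaw n
  set X : ℕ → (ℕ → Vec n) → ℝ := fun t ω => G (block m t ω) with hX
  have hTpos : (0 : ℝ) < T := by exact_mod_cast hT
  have hmeas : ∀ t, Measurable (X t) := fun t =>
    (Measurable.of_discrete (f := G)).comp (measurable_block m t)
  have hint : ∀ t, ∫ ω, X t ω ∂μ = (∑ w, G w) / (2 ^ n) ^ m := fun t => integral_block m t G
  have hind : iIndepFun (fun t ω => X t ω - ∫ ω, X t ω ∂μ) μ :=
    (iIndepFun_block m).comp (fun t w => G w - ∫ ω, X t ω ∂μ) fun t => Measurable.of_discrete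
  -- Hoeffding's lemma for a variable in `[0, 1]`: the variance proxy is `1 / 4`.
  have hsub : ∀ t < T, HasSubgaussianMGF (fun ω => X t ω - ∫ ω, X t ω ∂μ)
      ((‖(1 : ℝ) - 0‖₊ / 2) ^ 2) μ := fun t _ =>
    hasSubgaussianMGF_of_mem_Icc (hmeas t).aemeasurable
      (ae_of_all _ fun ω => ⟨h0 _, h1 _⟩)
  have hH := HasSubgaussianMGF.measure_sum_range_ge_le_of_iIndepFun hind hsub
    (ε := T * (ε / 2)) (by positivity)
  -- With total deviation `T * (ε / 2)` and proxy `T / 4` the exponent is `-(T * ε ^ 2 / 2)`, which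
  -- is at most `log δ` by `hTδ`.
  have hexp : Real.exp (-(T * (ε / 2)) ^ 2 / (2 * T * (((‖(1 : ℝ) - 0‖₊ / 2) ^ 2 : NNReal) : ℝ)))
      ≤ δ := by
    rw [← Real.exp_log hδ, Real.exp_le_exp]
    have e1 : (((‖(1 : ℝ) - 0‖₊ / 2) ^ 2 : NNReal) : ℝ) = 1 / 4 := by
      rw [sub_zero, nnnorm_one]; push_cast; norm_num
    have e2 : -(T * (ε / 2)) ^ 2 / (2 * T * (1 / 4 : ℝ)) = -(T * ε ^ 2 / 2) := by
      field_simp; ring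
    rw [e1, e2]
    rw [div_le_iff₀ (by positivity), Real.log_div one_ne_zero hδ.ne', Real.log_one] at hTδ
    linarith
  set Bad := {ω | T * (ε / 2) ≤ ∑ t ∈ Finset.range T, (X t ω - ∫ ω, X t ω ∂μ)} with hBad
  have hBadm : MeasurableSet Bad := by
    refine measurableSet_le measurable_const ?_
    exact Finset.measurable_sum _ fun t _ => (hmeas t).sub_const _
  have hcompl : Badᶜ ⊆ {ω | (∑ t ∈ Finset.range T, G (block m t ω)) / T ≤ ε} := by
    intro ω hω
    simp only [hBad, Set.mem_compl_iff, Set.mem_ofPred_eq, not_le, Finset.sum_sub_distrib, hint,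
      Finset.sum_const, Finset.card_range, nsmul_eq_mul] at hω
    rw [Set.mem_ofPred_eq, div_le_iff₀ hTpos]
    have h2 : (T : ℝ) * ((∑ w, G w) / (2 ^ n) ^ m) ≤ T * (ε / 2) :=
      mul_le_mul_of_nonneg_left hmean hTpos.le
    simp only [hX] at hω
    linarith
  refine le_trans ?_ (measure_mono hcompl)
  rw [← ofReal_measureReal (measure_ne_top _ _), probReal_compl_eq_one_sub hBadm]
  exact ENNReal.ofReal_le_ofReal (by linarith [hH.trans hexp])

/-! ## The error of one run -/

theorem runError_nonneg {n : ℕ} (f : Vec n → ℝ) (k : ℕ) (u : Fin k → Vec n) (b : Vec n) :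
    0 ≤ runError f k u b := by
  have h1 : ∑ α, fhat f α ^ 4
      ≤ ∑ c ∈ Finset.range (2 ^ k), l2Inner (fam k u f c) (fam k u f c) ^ 2 := by
    rw [← sum_fhat_fam_pow k u f 4 (by norm_num)]
    exact Finset.sum_le_sum fun c _ => sum_pow_four_le _
  have h2 : 0 ≤ ∑ c ∈ Finset.range (2 ^ k),
      (fam k u f c b ^ 2 - l2Inner (fam k u f c) (fam k u f c)) ^ 2 :=
    Finset.sum_nonneg fun _ _ => sq_nonneg _
  rw [runError]; linarith

/-- The bound on the error of a run with the random vectors `w`. -/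
def blockError {n : ℕ} (f : Vec n → ℝ) (d : ℕ) (lam κ : ℝ) (w : Fin (d + 1) → Vec n) : ℝ :=
  min 1 (lam * runError (trunc f (2 ^ d)) d (fun i => w ⟨d - i, by omega⟩) (w 0) + κ)

/-- The first vector of a block is the base point, the others are the directions in reverse order;
reindexing by `Fin.rev` undoes the reversal. -/
theorem sum_blocks {n : ℕ} (d : ℕ) (H : (Fin d → Vec n) → Vec n → ℝ) :
    ∑ w : Fin (d + 1) → Vec n, H (fun i => w ⟨d - i, by omega⟩) (w 0) = ∑ u, ∑ b, H u b := by
  rw [← Equiv.sum_comp (Fin.consEquiv fun _ => Vec n), Fintype.sum_prod_type, Finset.sum_comm,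
    ← Equiv.sum_comp (Equiv.arrowCongr Fin.revPerm (Equiv.refl (Vec n)))]
  refine Finset.sum_congr rfl fun v _ => Finset.sum_congr rfl fun b _ => ?_
  congr 1
  funext i
  have e : (⟨d - (i : ℕ), by omega⟩ : Fin (d + 1)) = Fin.succ (Fin.rev i) := by
    ext; simp [Fin.rev]; omega
  rw [e]
  simp [Fin.consEquiv]

theorem mean_blockError_le {n : ℕ} (f : Vec n → ℝ) (hf : l2Inner f f ≤ 1) (d : ℕ) {lam κ : ℝ}
    (hl : 0 ≤ lam) :
    (∑ w, blockError f d lam κ w) / (2 ^ n) ^ (d + 1) ≤ lam * (4 / 2 ^ d) + κ := by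
  have hP : (0 : ℝ) < (2 ^ n) ^ (d + 1) := by positivity
  rw [div_le_iff₀ hP]
  have h1 := sum_runError_le (trunc f (2 ^ d)) d ((l2Inner_trunc_le f _).trans hf)
    (m4_trunc_le f (by positivity) hf)
  rw [← sum_blocks d fun u b => runError (trunc f (2 ^ d)) d u b] at h1
  have h2 : ((Fintype.card (Fin (d + 1) → Vec n) : ℕ) : ℝ) = (2 ^ n) ^ (d + 1) := by
    rw [Fintype.card_pi, Finset.prod_const, Nat.cast_pow, card_vec]; simp
  calc _ ≤ ∑ w : Fin (d + 1) → Vec n,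
        (lam * runError (trunc f (2 ^ d)) d (fun i => w ⟨d - i, by omega⟩) (w 0) + κ) :=
        Finset.sum_le_sum fun w _ => min_le_right _ _
    _ ≤ _ := by
        rw [Finset.sum_add_distrib, ← Finset.mul_sum, Finset.sum_const, nsmul_eq_mul,
          Finset.card_univ, h2]
        nlinarith [mul_le_mul_of_nonneg_left h1 hl]

/-- The true energy lies in `[0, 1]`, so cutting the estimate off at `1` does not increase the error
and keeps it at most `1`. The right-hand side depends on the tape only through one block and takes
values at most `1`, as Hoeffding's inequality requires. -/
theorem abs_min_sub_le_blockError {n : ℕ} (f : Vec n → ℝ) (hf : l2Inner f f ≤ 1) (d s : ℕ)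
    {lam γ thr : ℝ} (hl : 0 < lam) (hγ : 0 < γ) {A : Finset (Vec n)} (hA : A.card ≤ s)
    (hmax : ∀ A' : Finset (Vec n), A'.card ≤ s → ∑ α ∈ A', fhat f α ^ 2 ≤ ∑ α ∈ A, fhat f α ^ 2)
    (ω : ℕ → Vec n) (t : ℕ) {F : ℝ}
    (hF : IsEstimate f d s thr (fun i => ω (t * (d + 1) + i)) F) :
    |min F 1 - ∑ α ∈ A, fhat f α ^ 2| ≤ blockError f d lam
      (s / (2 * lam) + s * thr + (s / (2 * γ * 2 ^ d) + 2 * γ)) (block (d + 1) t ω) := by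
  obtain ⟨W, lo, g, rfl, hW, hlo0, hg0, hg, hcount, hlo⟩ := hF
  have h1 := abs_topBound_sub_le f hf d _ _ hl hγ hlo0 hg0 hA hmax hW hcount hlo
  have hE0 : 0 ≤ ∑ α ∈ A, fhat f α ^ 2 := Finset.sum_nonneg fun _ _ => sq_nonneg _
  have hE1 : ∑ α ∈ A, fhat f α ^ 2 ≤ 1 := by
    rw [← parseval] at hf
    exact (Finset.sum_le_sum_of_subset_of_nonneg (Finset.subset_univ _)
      fun _ _ _ => sq_nonneg _).trans hf
  have hF0 : 0 ≤ topBound W (2 ^ d) s (lo + g) := by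
    simpa using sum_le_topBound W (2 ^ d) s (add_nonneg hlo0 hg0) (Finset.empty_subset _)
      (by simp)
  rw [blockError, le_min_iff]
  constructor
  · rw [abs_le]
    exact ⟨by linarith [le_min hF0 zero_le_one],
      by linarith [min_le_right (topBound W (2 ^ d) s (lo + g)) 1]⟩
  · refine le_trans ?_ (h1.trans ?_)
    · rw [abs_le]
      have h2 := abs_le.1 (le_refl |topBound W (2 ^ d) s (lo + g) - ∑ α ∈ A, fhat f α ^ 2|)
      constructor
      · rcases min_choice (topBound W (2 ^ d) s (lo + g)) 1 with h | h <;> rw [h]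
        · exact h2.1
        · have := abs_nonneg (topBound W (2 ^ d) s (lo + g) - ∑ α ∈ A, fhat f α ^ 2)
          linarith
      · linarith [min_le_left (topBound W (2 ^ d) s (lo + g)) 1, h2.2]
    · have h3 : (s : ℝ) * g ≤ s * thr := by gcongr
      have h4 : runError (trunc f (2 ^ d)) d (fun i : Fin d => ω (t * (d + 1) + (d - i)))
          (ω (t * (d + 1) + 0))
        = runError (trunc f (2 ^ d)) d (fun i => block (d + 1) t ω ⟨d - i, by omega⟩)
          (block (d + 1) t ω 0) := rfl
      rw [h4]
      linarith

/-- The choices are `lam = 16 * s / ε`, `γ = ε / 16` and bisection tolerance `ε / (s * 16)`. The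
five terms are at most `ε / 16`, `ε / 32`, `ε / 16`, `ε / 128` and `ε / 8`; the factor `1024` in the
number of buckets controls the first and the fourth. -/
theorem error_budget {s B ε : ℝ} (hs : 1 ≤ s) (hε : 0 < ε) (hB : s / (ε * ε) * 1024 ≤ B) :
    16 * s / ε * (4 / B) + (s / (2 * (16 * s / ε)) + s * (ε / (s * 16))
      + (s / (2 * (ε / 16) * B) + 2 * (ε / 16))) ≤ ε / 2 := by
  have hs0 : 0 < s := by linarith
  have hB0 : 0 < B := lt_of_lt_of_le (by positivity) hB
  have h1 : s / (ε * B) ≤ ε / 1024 := by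
    rw [div_mul_eq_mul_div, div_le_iff₀ (by positivity)] at hB
    rw [div_le_div_iff₀ (by positivity) (by norm_num)]
    nlinarith
  have e1 : 16 * s / ε * (4 / B) = 64 * (s / (ε * B)) := by field_simp; norm_num
  have e2 : s / (2 * (16 * s / ε)) = ε / 32 := by field_simp; norm_num
  have e3 : s * (ε / (s * 16)) = ε / 16 := by field_simp
  have e4 : s / (2 * (ε / 16) * B) = 8 * (s / (ε * B)) := by field_simp; norm_num
  rw [e1, e2, e3, e4]
  linarith

/-! ## The parameters -/

theorem exists_least (p : ℕ → Prop) (h : ∃ m, p m) : ∃ m, p m ∧ ∀ k < m, ¬ p k := by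
  classical
  exact ⟨Nat.find h, Nat.find_spec h, fun k hk => Nat.find_min h hk⟩

theorem half_le_log_two : 1 / 2 ≤ Real.log 2 := by linarith [Real.log_two_gt_d9]

theorem log_two_le_one : Real.log 2 ≤ 1 := by linarith [Real.log_two_lt_d9]

/-- Turns the minimality of a loop count into an upper bound: the last failing index is `m - 1`. The
maximum with `0` covers `m = 0`, where nothing is known about `x`. -/
theorem le_log_of_two_pow_lt {m : ℕ} {x : ℝ} (h : ∀ k < m, (2 : ℝ) ^ k < x) :
    m * Real.log 2 ≤ Real.log 2 + max 0 (Real.log x) := by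
  cases m with
  | zero =>
    have := half_le_log_two
    have h2 := le_max_left 0 (Real.log x)
    push_cast; linarith
  | succ m =>
    have h1 := h m (by omega)
    have h2 : m * Real.log 2 ≤ Real.log x := by
      rw [← Real.log_pow]
      exact Real.log_le_log (by positivity) h1.le
    have h3 := le_max_right 0 (Real.log x)
    push_cast; linarith

theorem half_le_log_inv {δ : ℝ} (h0 : 0 < δ) (h : δ ≤ 1 / 2) : 1 / 2 ≤ Real.log (1 / δ) := by
  refine half_le_log_two.trans (Real.log_le_log (by norm_num) ?_)
  rw [le_div_iff₀ h0]; linarith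

theorem halvings_bounds {δ : ℝ} {L : ℕ} (h0 : 0 < δ) (h : δ ≤ 1 / 2) (hL : (1 / 2) ^ L ≤ δ)
    (hL' : ∀ k < L, δ < (1 / 2) ^ k) :
    1 ≤ L ∧ Real.log (1 / δ) ≤ L ∧ (L : ℝ) ≤ 4 * Real.log (1 / δ) := by
  have h1 : 1 ≤ L := by
    by_contra hc
    have : L = 0 := by omega
    rw [this, pow_zero] at hL
    linarith
  refine ⟨h1, ?_, ?_⟩
  · have h2 : Real.log (1 / δ) ≤ L * Real.log 2 := by
      rw [← Real.log_pow]
      refine Real.log_le_log (by positivity) ?_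
      rw [div_le_iff₀ h0]
      calc (1 : ℝ) = 2 ^ L * (1 / 2) ^ L := by rw [← mul_pow]; norm_num
        _ ≤ _ := by gcongr
    have h3 := log_two_le_one
    have h4 : (0 : ℝ) ≤ L := Nat.cast_nonneg _
    nlinarith
  · have h2 : ∀ k < L, (2 : ℝ) ^ k < 1 / δ := by
      intro k hk
      have := hL' k hk
      rw [div_pow, one_pow] at this
      rwa [lt_div_comm₀ (by positivity) h0]
    have h3 := le_log_of_two_pow_lt h2
    have h4 : Real.log 2 ≤ Real.log (1 / δ) := by
      refine Real.log_le_log (by norm_num) ?_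
      rw [le_div_iff₀ h0]; linarith
    have h5 := half_le_log_two
    rw [max_eq_right (by linarith)] at h3
    have h6 : (0 : ℝ) ≤ L := Nat.cast_nonneg _
    nlinarith

/-- Minimality gives `2 ^ d ≤ 2048 * s / ε ^ 2` and `T ≤ 2 * L / ε ^ 2 + 1 ≤ 3 * L / ε ^ 2 ≤ 12 * Λ
/ ε ^ 2`; the constant is `12 * 2048`. -/
theorem runs_mul_buckets_le {s ε Λ : ℝ} {d L T : ℕ} (hs : 1 ≤ s) (hε : 0 < ε) (hε2 : ε < 1 / 2)
    (hd' : ∀ k < d, (2 : ℝ) ^ k < s / (ε * ε) * 1024) (hd1 : 1 ≤ d) (hL1 : 1 ≤ L)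
    (hL : (L : ℝ) ≤ 4 * Λ) (hT' : ∀ t < T, (t : ℝ) < L * (2 / (ε * ε))) :
    (T * 2 ^ d : ℝ) ≤ 24576 * (s / ε ^ 4 * Λ) := by
  have hL1' : (1 : ℝ) ≤ L := by exact_mod_cast hL1
  have hee : 1 ≤ 1 / (ε * ε) := by rw [le_div_iff₀ (by positivity)]; nlinarith
  have h1 : (2 : ℝ) ^ d ≤ 2048 * (s / (ε * ε)) := by
    have := hd' (d - 1) (by omega)
    have e : (2 : ℝ) ^ d = 2 * 2 ^ (d - 1) := by rw [← pow_succ', Nat.sub_add_cancel hd1]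
    rw [e]; linarith
  have h2 : (T : ℝ) ≤ 3 * (L * (1 / (ε * ε))) := by
    have e : (L : ℝ) * (2 / (ε * ε)) = 2 * (L * (1 / (ε * ε))) := by ring
    have hge : 1 ≤ (L : ℝ) * (1 / (ε * ε)) := one_le_mul_of_one_le_of_one_le hL1' hee
    cases T with
    | zero => push_cast; linarith
    | succ T =>
      have := hT' T (by omega)
      rw [e] at this
      push_cast; linarith
  have h3 : (T : ℝ) ≤ 12 * (Λ * (1 / (ε * ε))) := by
    have : (L : ℝ) * (1 / (ε * ε)) ≤ 4 * Λ * (1 / (ε * ε)) :=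
      mul_le_mul_of_nonneg_right hL (by positivity)
    linarith
  calc (T * 2 ^ d : ℝ) ≤ 12 * (Λ * (1 / (ε * ε))) * (2048 * (s / (ε * ε))) :=
        mul_le_mul h3 h1 (by positivity) ((Nat.cast_nonneg T).trans h3)
    _ = _ := by field_simp; ring

theorem dim_le {s ε : ℝ} {d : ℕ} (hs : 1 ≤ s) (hε : 0 < ε) (hε1 : ε ≤ 1)
    (hd' : ∀ k < d, (2 : ℝ) ^ k < s / (ε * ε) * 1024) :
    (d : ℝ) ≤ 11 * (1 + Real.log (s / ε)) := by
  have hs0 : 0 < s := by linarith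
  have hse : 1 ≤ s / ε := by rw [le_div_iff₀ hε]; linarith
  have hlog : 0 ≤ Real.log (s / ε) := Real.log_nonneg hse
  have h1 : ∀ k < d, (2 : ℝ) ^ k < (s / ε) ^ 2 * 2 ^ 10 := by
    intro k hk
    refine (hd' k hk).trans_le ?_
    have e : s / (ε * ε) * 1024 = s / (ε * ε) * 2 ^ 10 := by norm_num
    have e2 : (s / ε) ^ 2 = s * (s / (ε * ε)) := by field_simp
    rw [e, e2]
    have : s / (ε * ε) ≤ s * (s / (ε * ε)) := le_mul_of_one_le_left (by positivity) hs
    gcongr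
  have h2 := le_log_of_two_pow_lt h1
  have h3 := half_le_log_two
  rw [Real.log_mul (by positivity) (by positivity), Real.log_pow, Real.log_pow,
    max_eq_right (by push_cast; positivity)] at h2
  push_cast at h2
  nlinarith

theorem rounds_le {s ε : ℝ} {d R : ℕ} (hs : 1 ≤ s) (hε : 0 < ε) (hε1 : ε ≤ 1)
    (hd : (d : ℝ) ≤ 11 * (1 + Real.log (s / ε)))
    (hR' : ∀ k < R, ε / (s * 16) < 2 ^ d / 2 ^ k) :
    (R : ℝ) ≤ 18 * (1 + Real.log (s / ε)) := by
  have hs0 : 0 < s := by linarith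
  have hse : 1 ≤ s / ε := by rw [le_div_iff₀ hε]; linarith
  have hlog : 0 ≤ Real.log (s / ε) := Real.log_nonneg hse
  have h1 : ∀ k < R, (2 : ℝ) ^ k < s / ε * 2 ^ (d + 4) := by
    intro k hk
    have h := hR' k hk
    rw [lt_div_iff₀ (by positivity)] at h
    have e : s / ε * 2 ^ (d + 4) = 2 ^ d / (ε / (s * 16)) := by
      rw [pow_add]; field_simp; norm_num
    rw [e, lt_div_iff₀ (by positivity)]
    linarith
  have h2 := le_log_of_two_pow_lt h1
  have h3 := half_le_log_two
  rw [Real.log_mul (by positivity) (by positivity), Real.log_pow,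
    max_eq_right (by push_cast; positivity)] at h2
  push_cast at h2
  nlinarith

/-- The runs dominate: `43 + 9 * 11 + 13 * 18 = 376`, one more for the loop test, and `24576 * 377`
leaves room below `10 ^ 7` for the setup. -/
theorem time_le {s ε Λ ℓ : ℝ} {d L T R : ℕ} (hs : 1 ≤ s) (hε : 0 < ε) (hε1 : ε ≤ 1)
    (hΛ : 1 / 2 ≤ Λ) (hℓ : 1 ≤ ℓ) (hL : (L : ℝ) ≤ 4 * Λ) (hd : (d : ℝ) ≤ 11 * ℓ)
    (hR : (R : ℝ) ≤ 18 * ℓ) (hTB : (T * 2 ^ d : ℝ) ≤ 24576 * (s / ε ^ 4 * Λ)) :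
    33 + 4 * d + 3 * L + T * (1 + 2 ^ d * (43 + 9 * d + 13 * R))
      ≤ 10 ^ 7 * (s / ε ^ 4 * Λ * ℓ) := by
  set X := s / ε ^ 4 * Λ with hX
  have hX1 : Λ ≤ X := by
    have : 1 ≤ s / ε ^ 4 := by
      rw [le_div_iff₀ (by positivity), one_mul]
      exact (pow_le_one₀ hε.le hε1).trans hs
    exact le_mul_of_one_le_left (by linarith) this
  have hXℓ : X ≤ X * ℓ := le_mul_of_one_le_right (by linarith) hℓ
  have hℓX : ℓ ≤ 2 * (X * ℓ) := by nlinarith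
  have hB : (1 : ℝ) ≤ 2 ^ d := one_le_pow₀ (by norm_num)
  have hT0 : (0 : ℝ) ≤ T := Nat.cast_nonneg _
  have hTB0 : (0 : ℝ) ≤ T * 2 ^ d := by positivity
  have h1 : (T : ℝ) * (1 + 2 ^ d * (43 + 9 * d + 13 * R)) ≤ T * 2 ^ d * (377 * ℓ) := by
    have : (1 : ℝ) + 2 ^ d * (43 + 9 * d + 13 * R) ≤ 2 ^ d * (377 * ℓ) := by
      have h2 : (43 : ℝ) + 9 * d + 13 * R ≤ 376 * ℓ := by linarith
      nlinarith
    rw [mul_assoc]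
    exact mul_le_mul_of_nonneg_left this hT0
  have h2 : (T : ℝ) * 2 ^ d * (377 * ℓ) ≤ 24576 * X * (377 * ℓ) :=
    mul_le_mul_of_nonneg_right hTB (by linarith)
  nlinarith

/-! ## The guarantees -/

theorem exists_queries_of_lt_half {n s : ℕ} {ε δ : ℝ} (hs : 1 ≤ s) (hε : 0 < ε)
    (hε2 : ε < 1 / 2) (hδ : 0 < δ) (hδ2 : δ ≤ 1 / 2) :
    ∃ Q : (ℕ → Vec n) → List (Vec n),
      (∀ ω, ((Q ω).length : ℝ) ≤
        10 ^ 7 * ((s : ℝ) / ε ^ 4 * Real.log (1 / ε) * Real.log (1 / δ))) ∧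
      ∀ f : Vec n → ℝ, l2Norm f = 1 →
        (∀ ω, ∃ (ξ : ℝ) (t : ℕ), Runs estimateProg n s ε δ f ω ξ (Q ω) t ∧
          (t : ℝ) ≤ 10 ^ 7 * ((s : ℝ) / ε ^ 4 * Real.log (1 / δ) *
            (1 + Real.log ((s : ℝ) / ε)) ^ 1)) ∧
        ENNReal.ofReal (1 - δ) ≤
          tapeLaw n {ω | ∃ (ξ : ℝ) (t : ℕ), Runs estimateProg n s ε δ f ω ξ (Q ω) t ∧
            |ξ - distSparse f s ^ 2| ≤ ε} := by
  have hsR : (1 : ℝ) ≤ s := by exact_mod_cast hs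
  have hs0 : (0 : ℝ) < s := by linarith
  have hε1 : ε ≤ 1 := by linarith
  -- These four numbers are exactly the iteration counts at which the loops of the program stop.
  obtain ⟨d, hd, hd'⟩ := exists_least (fun d => (s : ℝ) / (ε * ε) * 1024 ≤ 2 ^ d)
    ((pow_unbounded_of_one_lt _ (by norm_num)).imp fun _ h => h.le)
  obtain ⟨L, hL, hL'⟩ := exists_least (fun L => (1 / 2 : ℝ) ^ L ≤ δ)
    ((exists_pow_lt_of_lt_one hδ (by norm_num)).imp fun _ h => h.le)
  obtain ⟨T, hT, hT'⟩ := exists_least (fun T => (L : ℝ) * (2 / (ε * ε)) ≤ T) (exists_nat_ge _)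
  obtain ⟨R, hR, hR'⟩ := exists_least (fun R => (2 : ℝ) ^ d / 2 ^ R ≤ ε / (s * 16)) (by
    obtain ⟨R, h⟩ := pow_unbounded_of_one_lt (2 ^ d / (ε / (s * 16))) (one_lt_two (α := ℝ))
    exact ⟨R, by
      rw [div_le_iff₀ (by positivity)]
      rw [div_lt_iff₀ (by positivity)] at h
      linarith⟩)
  simp only [not_le] at hd' hL' hT' hR'
  have hd1 : 1 ≤ d := by
    by_contra hc
    have h0 : d = 0 := by omega
    rw [h0, pow_zero, div_mul_eq_mul_div, div_le_iff₀ (by positivity)] at hd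
    nlinarith
  obtain ⟨hL1, hLlow, hLup⟩ := halvings_bounds hδ hδ2 hL hL'
  have hL1' : (1 : ℝ) ≤ L := by exact_mod_cast hL1
  have hT1 : 1 ≤ T := by
    by_contra hc
    have h0 : T = 0 := by omega
    rw [h0] at hT
    have : 0 < (L : ℝ) * (2 / (ε * ε)) := by positivity
    push_cast at hT
    linarith
  have hΛ := half_le_log_inv hδ hδ2
  have hTB := runs_mul_buckets_le hsR hε hε2 hd' hd1 hL1 hLup hT'
  have hdl := dim_le hsR hε hε1 hd'
  have hRl := rounds_le hsR hε hε1 hdl hR'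
  have hℓ : 1 ≤ 1 + Real.log ((s : ℝ) / ε) := by
    have : 1 ≤ (s : ℝ) / ε := by rw [le_div_iff₀ hε]; linarith
    linarith [Real.log_nonneg this]
  have htime := time_le hsR hε hε1 hΛ hℓ hLup hdl hRl hTB
  refine ⟨fun ω => allQueries d ω T, fun ω => ?_, fun f hf => ?_⟩
  · rw [length_allQueries]
    push_cast
    -- The construction needs no factor `log (1 / ε)`; below `1 / 2` that factor is at least `1 / 2`
    -- and is absorbed by the constant.
    have h1 := half_le_log_inv hε hε2.le
    have h2 : 0 ≤ (s : ℝ) / ε ^ 4 * Real.log (1 / δ) := by positivity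
    nlinarith
  have hf1 : l2Inner f f ≤ 1 := by rw [← l2Norm_sq, hf]; norm_num
  obtain ⟨A, hA, hmax⟩ := exists_isGreatest_energies f s
  have hdist : distSparse f s ^ 2 = 1 - ∑ α ∈ A, fhat f α ^ 2 := by
    rw [distSparse_sq f s hA hmax, ← l2Norm_sq, hf, one_pow]
  set κ : ℝ := s / (2 * (16 * s / ε)) + s * (ε / (s * 16))
    + (s / (2 * (ε / 16) * 2 ^ d) + 2 * (ε / 16)) with hκ
  set G := blockError f d (16 * s / ε) κ with hG
  have hrun : ∀ ω, ∃ (ξ : ℝ) (t : ℕ), Runs estimateProg n s ε δ f ω ξ (allQueries d ω T) t ∧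
      t ≤ 33 + 4 * d + 3 * L + T * (1 + 2 ^ d * (43 + 9 * d + 13 * R)) ∧
      |ξ - distSparse f s ^ 2| ≤ (∑ t ∈ Finset.range T, G (block (d + 1) t ω)) / T := by
    intro ω
    obtain ⟨σ, hexec, h1, h2, h3⟩ := wp_estimateProg (f := f) (ω := ω) s d L T R ε δ
      (∑ α ∈ A, fhat f α ^ 2) (fun t => G (block (d + 1) t ω)) hε2 hd hd' hd1 hL hL' hT hT' hT1
      hR hR' fun t F hF => abs_min_sub_le_blockError f hf1 d s (by positivity) (by positivity)
        hA hmax ω t hF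
    exact ⟨σ.real 0, σ.time, ⟨σ, hexec, rfl, h2, rfl⟩, h3, by rwa [hdist]⟩
  refine ⟨fun ω => ?_, ?_⟩
  · obtain ⟨ξ, t, h1, h2, -⟩ := hrun ω
    refine ⟨ξ, t, h1, ?_⟩
    rw [pow_one]
    refine le_trans ?_ htime
    exact_mod_cast h2
  · have hκ0 : 0 ≤ κ := by positivity
    -- Only an inclusion of events is used, so measurability of the accuracy event is not needed.
    refine (tapeLaw_mean_le (d + 1) T hT1 G (fun w => ?_) (fun w => min_le_left _ _) hε hδ ?_
      ?_).trans (measure_mono fun ω hω => ?_)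
    · exact le_min zero_le_one
        (add_nonneg (mul_nonneg (by positivity) (runError_nonneg _ _ _ _)) hκ0)
    · exact (mean_blockError_le f hf1 d (by positivity)).trans (error_budget hsR hε hd)
    -- The number of halvings `L` is at least the natural logarithm of `1 / δ`, because `log 2 ≤ 1`.
    · refine le_trans ?_ hT
      rw [mul_comm 2, mul_div_assoc, ← sq]
      gcongr
    · obtain ⟨ξ, t, h1, -, h2⟩ := hrun ω
      exact ⟨ξ, t, h1, h2.trans hω⟩

/-- The squared distance lies in `[0, 1]`, so the output `1 / 2` is always accurate. An empty query
list is forced at `ε = 1`, where the query bound vanishes. -/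
theorem exists_queries_of_half_le {n s : ℕ} {ε δ : ℝ} (hs : 1 ≤ s) (hε1 : ε ≤ 1)
    (hε2 : 1 / 2 ≤ ε) (hδ : 0 < δ) (hδ2 : δ ≤ 1 / 2) :
    ∃ Q : (ℕ → Vec n) → List (Vec n),
      (∀ ω, ((Q ω).length : ℝ) ≤
        10 ^ 7 * ((s : ℝ) / ε ^ 4 * Real.log (1 / ε) * Real.log (1 / δ))) ∧
      ∀ f : Vec n → ℝ, l2Norm f = 1 →
        (∀ ω, ∃ (ξ : ℝ) (t : ℕ), Runs estimateProg n s ε δ f ω ξ (Q ω) t ∧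
          (t : ℝ) ≤ 10 ^ 7 * ((s : ℝ) / ε ^ 4 * Real.log (1 / δ) *
            (1 + Real.log ((s : ℝ) / ε)) ^ 1)) ∧
        ENNReal.ofReal (1 - δ) ≤
          tapeLaw n {ω | ∃ (ξ : ℝ) (t : ℕ), Runs estimateProg n s ε δ f ω ξ (Q ω) t ∧
            |ξ - distSparse f s ^ 2| ≤ ε} := by
  have hsR : (1 : ℝ) ≤ s := by exact_mod_cast hs
  have hε : 0 < ε := by linarith
  have hΛ := half_le_log_inv hδ hδ2
  have hlog : 0 ≤ Real.log ((s : ℝ) / ε) :=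
    Real.log_nonneg (by rw [le_div_iff₀ hε]; linarith)
  have hlogε : 0 ≤ Real.log (1 / ε) := Real.log_nonneg (by rw [le_div_iff₀ hε]; linarith)
  refine ⟨fun _ => [], fun ω => ?_, fun f hf => ?_⟩
  · simp only [List.length_nil, Nat.cast_zero]
    positivity
  have hrun : ∀ ω, Runs estimateProg n s ε δ f ω (1 / 2) [] 3 := fun ω =>
    wp_estimateProg_large s ε δ hε2
  obtain ⟨A, hA, hmax⟩ := exists_isGreatest_energies f s
  have hdist : distSparse f s ^ 2 = 1 - ∑ α ∈ A, fhat f α ^ 2 := by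
    rw [distSparse_sq f s hA hmax, ← l2Norm_sq, hf, one_pow]
  refine ⟨fun ω => ⟨1 / 2, 3, hrun ω, ?_⟩, ?_⟩
  · have h1 : 1 ≤ (s : ℝ) / ε ^ 4 := by
      rw [le_div_iff₀ (by positivity), one_mul]
      exact (pow_le_one₀ hε.le hε1).trans hsR
    have h2 : 1 / 2 ≤ (s : ℝ) / ε ^ 4 * Real.log (1 / δ) := by nlinarith
    rw [pow_one]
    push_cast
    nlinarith
  · have huniv : {ω : ℕ → Vec n | ∃ (ξ : ℝ) (t : ℕ), Runs estimateProg n s ε δ f ω ξ [] t ∧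
        |ξ - distSparse f s ^ 2| ≤ ε} = Set.univ := by
      refine Set.eq_univ_of_forall fun ω => ⟨1 / 2, 3, hrun ω, ?_⟩
      have h1 := sq_nonneg (distSparse f s)
      have h2 : 0 ≤ ∑ α ∈ A, fhat f α ^ 2 := Finset.sum_nonneg fun _ _ => sq_nonneg _
      rw [abs_le]
      constructor <;> linarith
    rw [huniv, measure_univ]
    exact ENNReal.ofReal_le_one.2 (by linarith)

end FourierSparsity

end

theorem theorem1 :
    -- one program and absolute constants, for all dimensions and parameters
    ∃ (P : Prog) (C : ℝ) (k : ℕ), 0 < C ∧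
      ∀ (n s : ℕ) (ε δ : ℝ), 1 ≤ s → 0 < ε → ε ≤ 1 → 0 < δ → δ ≤ 1 / 2 →
        -- the queries are determined by the random tape alone, before `f` is known
        ∃ Q : (ℕ → Vec n) → List (Vec n),
          (∀ ω, ((Q ω).length : ℝ) ≤
            C * ((s : ℝ) / ε ^ 4 * Real.log (1 / ε) * Real.log (1 / δ))) ∧
          ∀ f : Vec n → ℝ, l2Norm f = 1 →
            -- termination, with the queries `Q ω` and within the running time
            (∀ ω, ∃ (ξ : ℝ) (t : ℕ), Runs P n s ε δ f ω ξ (Q ω) t ∧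
              (t : ℝ) ≤ C * ((s : ℝ) / ε ^ 4 * Real.log (1 / δ) *
                (1 + Real.log ((s : ℝ) / ε)) ^ k)) ∧
            -- accuracy
            ENNReal.ofReal (1 - δ) ≤
              tapeLaw n {ω | ∃ (ξ : ℝ) (t : ℕ), Runs P n s ε δ f ω ξ (Q ω) t ∧
                |ξ - distSparse f s ^ 2| ≤ ε} ∧
            -- the quantity estimated is one minus the energy of the top `s` coefficients
            IsGreatest (energies f s) (1 - distSparse f s ^ 2) := by
  -- A single logarithmic factor suffices in the time bound: the transform has `d` rounds and the
  -- bisection `R`, both of order `1 + log (s / ε)`.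
  refine ⟨estimateProg, 10 ^ 7, 1, by norm_num, fun n s ε δ hs hε hε1 hδ hδ2 => ?_⟩
  rcases lt_or_ge ε (1 / 2) with hε2 | hε2
  · obtain ⟨Q, h1, h2⟩ := exists_queries_of_lt_half (n := n) hs hε hε2 hδ hδ2
    exact ⟨Q, h1, fun f hf => ⟨(h2 f hf).1, (h2 f hf).2, isGreatest_energies f s hf⟩⟩
  · obtain ⟨Q, h1, h2⟩ := exists_queries_of_half_le (n := n) hs hε1 hε2 hδ hδ2
    exact ⟨Q, h1, fun f hf => ⟨(h2 f hf).1, (h2 f hf).2, isGreatest_energies f s hf⟩⟩
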